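/- **Setting.** Let $G=(V,E)$ be a finite connected graph with vertex boundary $\delta V$: a finite set disjoint from $V$, every element of which is adjacent to at least one vertex of $V$. Let $\alpha_0>0$, $t\ge 0$ and let $\mathbb{K}$ be $\mathbb{R}$ or $\mathbb{C}$. For a potential $\eta:V\to\mathbb{K}$ consider the boundary value problem for $u:V\cup\delta V\to\mathbb{K}$ $$\sum_{y\sim x}[u(x)-u(y)]+\alpha_0[1+\eta(x)]u(x)=f(x)\ \ (x\in V),\qquad t\,u(x)+\sum_{y\in V,\,y\sim x}[u(x)-u(y)]=g(x)\ \ (x\in\delta V).$$ It is uniquely solvable when $\eta\ge 0$. Let $G_\eta$ be its Green's function: $G_\eta(x,y)$ is the value at $x$ of the solution for a unit source at $y$; $G_0$ is the one for $\eta\equiv 0$, and $G_0^{U;W}$ denotes its submatrix with rows in $U$ and columns in $W$. Let $R,S\subseteq\delta V$ (receivers and sources). The Robin-to-Dirichlet map is $\Lambda_\eta(r,s)=G_\eta(r,s)$ for $r\in R$, $s\in S$, and the scattering data of $\eta$ are $\phi_\eta=G_0-\Lambda_\eta\in\mathbb{K}^{R\times S}$. For $j\ge1$ put $$K_j(\eta_1,\dots,\eta_j)(r,s)=-(-\alpha_0)^j\,G_0^{r;V}D_{\eta_1}G_0^{V;V}D_{\eta_2}\cdots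 G_0^{V;V}D_{\eta_j}G_0^{V;s},$$ where $D_\eta$ is the diagonal matrix with diagonal $\eta$; these are the terms of the forward Born series $\phi_\eta=\sum_{j\ge1}K_j(\eta,\dots,\eta)$, valid for small $\eta$. Let $p,q\in[1,\infty]$ with $1/p+1/q=1$ and put $$\mu_p=\alpha_0\max_{v\in V}\|G_0^{V;v}\|_{\ell^q(V)},\qquad \nu_p=\alpha_0\,\big\|\,r\mapsto\|G_0^{r;V}\|_{\ell^q(V)}\big\|_{\ell^p(R)}\,\big\|\,s\mapsto\|G_0^{V;s}\|_{\ell^q(V)}\big\|_{\ell^p(S)},\qquad C_p=\min_{\eta\in\mathbb{K}^V,\ \|\eta\|_p=1}\|K_1(\eta)\|_p.$$ Assume $|V|=|R\times S|$ and that $K_1:\mathbb{K}^V\to\mathbb{K}^{R\times S}$ is invertible. The inverse Born series is $\sum_{j\ge1}\mathcal{K}_j(\phi,\dots,\phi)$, where $\mathcal{K}_1=K_1^{-1}$ and, for $j\ge 2$, $$\mathcal{K}_j=-\Big(\sum_{m=1}^{j-1}\mathcal{K}_m\sum_{i_1+\cdots+i_m=j}K_{i_1}\otimes\cdots\otimes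 K_{i_m}\Big)\,\mathcal{K}_1\otimes\cdots\otimes\mathcal{K}_1 ,$$ with $i_1,\dots,i_m\ge 1$. Put $$r_p=\frac{C_p}{\mu_p}\left[1-2\frac{\nu_p}{C_p}\left(\sqrt{1+\frac{C_p}{\nu_p}}-1\right)\right],\qquad \rho_p=\frac1{\mu_p}\left[1-\Big(1+\frac{C_p}{\nu_p}\Big)^{-1/2}\right].$$ **Theorem.** 1. Let $\eta:V\to\mathbb{K}$ be either real-valued and non-negative, or arbitrary with $\|\eta\|_p<\rho_p$. If $\|\phi_\eta\|_p<r_p$, then the inverse Born series $\sum_{j\ge1}\mathcal{K}_j(\phi_\eta,\dots,\phi_\eta)$ converges (absolutely), and its sum is the original potential $\eta$. 2. For every $\phi\in\mathbb{K}^{R\times S}$ with $\|\phi\|_p<r_p$ the inverse Born series $\sum_{j\ge1}\mathcal{K}_j(\phi,\dots,\phi)$ converges (absolutely), and its sum is a potential $\eta\in\mathbb{K}^V$ with $\|\eta\|_p<\rho_p$ for which the boundary value problem is uniquely solvable and whose scattering data are $\phi_\eta=\phi$. -/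

import Mathlib

/-!
Optical tomography on a finite graph.  `V` is the set of interior vertices and `B` the vertex
boundary, so a function on the closure is a function `u : V ⊕ B → 𝕜`.  Edges between two boundary
vertices are allowed but do not enter the equations.
-/

section

variable {𝕜 : Type*} [RCLike 𝕜] {V B : Type*} [Fintype V] [Fintype B]
  (Γ : SimpleGraph (V ⊕ B)) [DecidableRel Γ.Adj] (α₀ t : ℝ)

/-- The left-hand side of the diffusion equation with Robin boundary condition:
`(L u)(x) + α₀ (1 + η x) u x` at an interior vertex `x`, where `L` is the combinatorial Laplacian,
and `t u(x) + ∂u(x)` at a boundary vertex `x`, where `∂u` only involves interior neighbours. -/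
def diffusionOp (η : V → 𝕜) (u : V ⊕ B → 𝕜) : V ⊕ B → 𝕜
  | Sum.inl x =>
      (∑ y : V ⊕ B, if Γ.Adj (Sum.inl x) y then u (Sum.inl x) - u y else 0)
        + (α₀ : 𝕜) * (1 + η x) * u (Sum.inl x)
  | Sum.inr x =>
      (t : 𝕜) * u (Sum.inr x)
        + ∑ y : V, if Γ.Adj (Sum.inr x) (Sum.inl y) then u (Sum.inr x) - u (Sum.inl y) else 0

variable [DecidableEq V] [DecidableEq B]

/-- The matrix of `diffusionOp`. -/
def diffusionMatrix (η : V → 𝕜) : Matrix (V ⊕ B) (V ⊕ B) 𝕜 :=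
  Matrix.of fun x y => diffusionOp Γ α₀ t η (Pi.single y 1) x

/-- The Green's function for the potential `η`: its `(x, y)` entry is the value at `x` of the
solution with a unit source at `y` (see `diffusionOp_eq_iff`). -/
noncomputable def greenMatrix (η : V → 𝕜) : Matrix (V ⊕ B) (V ⊕ B) 𝕜 :=
  (diffusionMatrix Γ α₀ t η)⁻¹

/-- The background Green's function, for the potential `0`. -/
noncomputable def greenZero (𝕜 : Type*) [RCLike 𝕜] : Matrix (V ⊕ B) (V ⊕ B) 𝕜 :=
  greenMatrix Γ α₀ t (0 : V → 𝕜)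

variable (R S : Finset B)

/-- The Robin-to-Dirichlet map: the value at the receiver `r` of the solution for a unit
boundary source at `s`. -/
noncomputable def robinToDirichlet (η : V → 𝕜) (rs : R × S) : 𝕜 :=
  greenMatrix Γ α₀ t η (Sum.inr rs.1.1) (Sum.inr rs.2.1)

/-- The scattering data `G₀(r,s) - Λ_η(r,s)` of the potential `η`. -/
noncomputable def scatteringData (η : V → 𝕜) (rs : R × S) : 𝕜 :=
  greenZero Γ α₀ t 𝕜 (Sum.inr rs.1.1) (Sum.inr rs.2.1) - robinToDirichlet Γ α₀ t R S η rs

/-- The submatrix of `G₀` with rows in `R` and columns in `V`. -/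
noncomputable def greenRV (𝕜 : Type*) [RCLike 𝕜] : Matrix R V 𝕜 :=
  (greenZero Γ α₀ t 𝕜).submatrix (fun r => Sum.inr r.1) Sum.inl

/-- The submatrix of `G₀` with rows and columns in `V`. -/
noncomputable def greenVV (𝕜 : Type*) [RCLike 𝕜] : Matrix V V 𝕜 :=
  (greenZero Γ α₀ t 𝕜).submatrix Sum.inl Sum.inl

/-- The submatrix of `G₀` with rows in `V` and columns in `S`. -/
noncomputable def greenVS (𝕜 : Type*) [RCLike 𝕜] : Matrix V S 𝕜 :=
  (greenZero Γ α₀ t 𝕜).submatrix Sum.inl (fun s => Sum.inr s.1)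

/-- The `j`-th (multilinear) term of the forward Born series,
`K_j(η₁,…,η_j)(r,s) = -(-α₀)^j G₀^{r;V} D_{η₁} G₀^{V;V} D_{η₂} ⋯ G₀^{V;V} D_{η_j} G₀^{V;s}`,
normalized so that `G₀ - Λ_η = ∑_{j ≥ 1} K_j(η,…,η)`; there is no term of order `0`. -/
noncomputable def forwardBorn : (j : ℕ) → (Fin j → V → 𝕜) → (R × S → 𝕜)
  | 0, _ => 0
  | n + 1, η => fun rs =>
      -(-(α₀ : 𝕜)) ^ (n + 1) *
        (greenRV Γ α₀ t R 𝕜 * Matrix.diagonal (η 0)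
          * (List.ofFn fun i : Fin n => greenVV Γ α₀ t 𝕜 * Matrix.diagonal (η i.succ)).prod
          * greenVS Γ α₀ t S 𝕜) rs.1 rs.2

/-- The operators `𝒦_j` of the inverse Born series, with `𝒦₁ = T`:
`𝒦_j = -(∑_{m=1}^{j-1} 𝒦_m ∑_{i₁+⋯+i_m=j} K_{i₁} ⊗ ⋯ ⊗ K_{i_m}) 𝒦₁ ⊗ ⋯ ⊗ 𝒦₁`.
The double sum runs over the compositions `c` of `j` with `c.length = m < j` blocks of sizes
`i₁, …, i_m`; `c.embedding k` lists the positions in the `k`-th block. -/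
noncomputable def inverseBorn (T : (R × S → 𝕜) → (V → 𝕜)) :
    (j : ℕ) → (Fin j → (R × S → 𝕜)) → (V → 𝕜)
  | 0, _ => 0
  | 1, φ => T (φ 0)
  | n + 2, φ =>
      -∑ c : {c : Composition (n + 2) // c.length < n + 2},
        have : c.1.length < n + 2 := c.2
        inverseBorn T c.1.length fun k =>
          forwardBorn Γ α₀ t R S (c.1.blocksFun k) fun i => T (φ (c.1.embedding k i))

/-- The `ℓ^p` norm of a finite vector. -/
noncomputable def lpNorm {ι E : Type*} [Fintype ι] [NormedAddCommGroup E]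
    (p : ENNReal) (x : ι → E) : ℝ :=
  ‖WithLp.toLp p x‖

/-- `μ_p = α₀ max_{v ∈ V} ‖G₀^{V;v}‖_{ℓ^q(V)}`, with `q` the exponent conjugate to `p`. -/
noncomputable def muConst (𝕜 : Type*) [RCLike 𝕜] (q : ENNReal) : ℝ :=
  α₀ * ⨆ v : V, lpNorm q fun w => greenVV Γ α₀ t 𝕜 w v

/-- `ν_p = α₀ ‖G₀^{R;V}‖_{ℓ^q(V) × ℓ^p(R)} ‖G₀^{V;S}‖_{ℓ^q(V) × ℓ^p(S)}`, where the mixed norms are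
the `ℓ^p` norm over `R` (or `S`) of the `ℓ^q` norms over `V`. -/
noncomputable def nuConst (𝕜 : Type*) [RCLike 𝕜] (p q : ENNReal) : ℝ :=
  α₀ * (lpNorm p fun r : R => lpNorm q fun v => greenRV Γ α₀ t R 𝕜 r v)
    * (lpNorm p fun s : S => lpNorm q fun v => greenVS Γ α₀ t S 𝕜 v s)

/-- `C_p = min_{‖η‖_p = 1} ‖K₁ η‖_p`. -/
noncomputable def cConst (𝕜 : Type*) [RCLike 𝕜] (p : ENNReal) : ℝ :=
  sInf ((fun η : V → 𝕜 => lpNorm p (forwardBorn Γ α₀ t R S 1 fun _ => η))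
    '' {η | lpNorm p η = 1})

end

/-- `r_p = (C/μ) [1 - 2 (ν/C) (√(1 + C/ν) - 1)]`. -/
noncomputable def bornRadius (C μ ν : ℝ) : ℝ :=
  C / μ * (1 - 2 * (ν / C) * (√(1 + C / ν) - 1))

/-- `ρ_p = (1/μ) (1 - 1 / √(1 + C/ν))`, the radius of the ball of potentials. -/
noncomputable def potentialRadius (C μ ν : ℝ) : ℝ :=
  1 / μ * (1 - 1 / √(1 + C / ν))

/-! For nonnegative potentials the boundary value problem is uniquely solvable, so that
`greenMatrix` is its solution operator. -/

section

variable {𝕜 : Type*} [RCLike 𝕜] {V B : Type*} [Fintype V] [Fintype B]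
  (Γ : SimpleGraph (V ⊕ B)) [DecidableRel Γ.Adj] (α₀ t : ℝ)

theorem diffusionOp_add (η : V → 𝕜) (u w : V ⊕ B → 𝕜) :
    diffusionOp Γ α₀ t η (u + w) = diffusionOp Γ α₀ t η u + diffusionOp Γ α₀ t η w := by
  have key : ∀ (P : Prop) [Decidable P] (a b c d : 𝕜), (if P then a + b - (c + d) else 0)
      = (if P then a - c else 0) + (if P then b - d else 0) := by
    intro P _ a b c d; split_ifs <;> ring
  funext x
  cases x <;> simp only [diffusionOp, Pi.add_apply, key, Finset.sum_add_distrib] <;> ring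

theorem diffusionOp_smul (η : V → 𝕜) (a : 𝕜) (u : V ⊕ B → 𝕜) :
    diffusionOp Γ α₀ t η (a • u) = a • diffusionOp Γ α₀ t η u := by
  funext x
  cases x <;>
    simp only [diffusionOp, Pi.smul_apply, smul_eq_mul, mul_add, Finset.mul_sum, mul_ite,
      mul_zero, mul_sub] <;> ring

theorem diffusionMatrix_mulVec [DecidableEq V] [DecidableEq B] (η : V → 𝕜) (u : V ⊕ B → 𝕜) :
    Matrix.mulVec (diffusionMatrix Γ α₀ t η) u = diffusionOp Γ α₀ t η u := by
  let L : (V ⊕ B → 𝕜) →ₗ[𝕜] (V ⊕ B → 𝕜) :=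
    { toFun := diffusionOp Γ α₀ t η
      map_add' := diffusionOp_add Γ α₀ t η
      map_smul' := diffusionOp_smul Γ α₀ t η }
  have h : diffusionMatrix Γ α₀ t η = LinearMap.toMatrix' L := by
    ext x y
    simp [diffusionMatrix, LinearMap.toMatrix'_apply, L]
  rw [h, LinearMap.toMatrix'_mulVec]
  rfl

/-- Maximum principle: for a nonnegative potential the homogeneous problem has only the zero
solution. -/
theorem diffusionOp_eq_zero (hB : ∀ b : B, ∃ v : V, Γ.Adj (Sum.inr b) (Sum.inl v))
    (hα : 0 < α₀) (ht : 0 ≤ t) (η : V → ℝ) (hη : ∀ v, 0 ≤ η v) (u : V ⊕ B → 𝕜)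
    (hu : diffusionOp Γ α₀ t (fun v => (η v : 𝕜)) u = 0) : u = 0 := by
  have hint : ∀ v : V, (∀ y, ‖u y‖ ≤ ‖u (Sum.inl v)‖) → ‖u (Sum.inl v)‖ = 0 := by
    intro v hv
    have h := congrFun hu (Sum.inl v)
    simp only [diffusionOp, Pi.zero_apply] at h
    set N : ℝ := ∑ y : V ⊕ B, if Γ.Adj (Sum.inl v) y then (1 : ℝ) else 0 with hN
    have hN0 : 0 ≤ N := Finset.sum_nonneg fun y _ => by split_ifs <;> norm_num
    have h1 : ((N + α₀ * (1 + η v) : ℝ) : 𝕜) * u (Sum.inl v)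
        = ∑ y : V ⊕ B, if Γ.Adj (Sum.inl v) y then u y else 0 := by
      have h2 : (∑ y : V ⊕ B, if Γ.Adj (Sum.inl v) y then u (Sum.inl v) - u y else 0)
          = (N : 𝕜) * u (Sum.inl v) - ∑ y : V ⊕ B, if Γ.Adj (Sum.inl v) y then u y else 0 := by
        rw [hN, RCLike.ofReal_sum, Finset.sum_mul, ← Finset.sum_sub_distrib]
        refine Finset.sum_congr rfl fun y _ => ?_
        split_ifs <;> simp
      rw [h2] at h
      push_cast
      linear_combination h
    have h3 : ‖∑ y : V ⊕ B, if Γ.Adj (Sum.inl v) y then u y else 0‖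
        ≤ N * ‖u (Sum.inl v)‖ := by
      refine (norm_sum_le _ _).trans ?_
      rw [hN, Finset.sum_mul]
      refine Finset.sum_le_sum fun y _ => ?_
      split_ifs
      · simpa using hv y
      · simp
    have hpos : 0 < α₀ * (1 + η v) := mul_pos hα (by linarith [hη v])
    rw [← h1, norm_mul, RCLike.norm_ofReal, abs_of_nonneg (by linarith)] at h3
    nlinarith [norm_nonneg (u (Sum.inl v))]
  have hbd : ∀ b : B, (∀ y, ‖u y‖ ≤ ‖u (Sum.inr b)‖) → ‖u (Sum.inr b)‖ = 0 := by
    intro b hb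
    obtain ⟨v, hv⟩ := hB b
    have h := congrFun hu (Sum.inr b)
    simp only [diffusionOp, Pi.zero_apply] at h
    set N : ℝ := ∑ y : V, if Γ.Adj (Sum.inr b) (Sum.inl y) then (1 : ℝ) else 0 with hN
    have hN0 : 0 ≤ N := Finset.sum_nonneg fun y _ => by split_ifs <;> norm_num
    have h1 : ((t + N : ℝ) : 𝕜) * u (Sum.inr b)
        = ∑ y : V, if Γ.Adj (Sum.inr b) (Sum.inl y) then u (Sum.inl y) else 0 := by
      have h2 : (∑ y : V, if Γ.Adj (Sum.inr b) (Sum.inl y) then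
            u (Sum.inr b) - u (Sum.inl y) else 0) = (N : 𝕜) * u (Sum.inr b)
            - ∑ y : V, if Γ.Adj (Sum.inr b) (Sum.inl y) then u (Sum.inl y) else 0 := by
        rw [hN, RCLike.ofReal_sum, Finset.sum_mul, ← Finset.sum_sub_distrib]
        refine Finset.sum_congr rfl fun y _ => ?_
        split_ifs <;> simp
      rw [h2] at h
      push_cast
      linear_combination h
    have hmax : ‖u (Sum.inr b)‖ ≤ ‖u (Sum.inl v)‖ := by
      by_contra! hlt
      have h3 : ‖∑ y : V, if Γ.Adj (Sum.inr b) (Sum.inl y) then u (Sum.inl y) else 0‖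
          < N * ‖u (Sum.inr b)‖ := by
        refine (norm_sum_le _ _).trans_lt ?_
        rw [hN, Finset.sum_mul]
        refine Finset.sum_lt_sum (fun y _ => ?_) ⟨v, Finset.mem_univ v, ?_⟩
        · split_ifs
          · simpa using hb (Sum.inl y)
          · simp
        · simpa [hv] using hlt
      rw [← h1, norm_mul, RCLike.norm_ofReal, abs_of_nonneg (by linarith)] at h3
      nlinarith [norm_nonneg (u (Sum.inr b))]
    have h0 := hint v fun y => (hb y).trans hmax
    exact le_antisymm (hmax.trans h0.le) (norm_nonneg _)
  by_cases hne : Nonempty (V ⊕ B)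
  swap
  · funext x; exact (hne ⟨x⟩).elim
  obtain ⟨x₀, hx₀⟩ := Finite.exists_max fun x => ‖u x‖
  have hzero : ‖u x₀‖ = 0 := by
    cases x₀ with
    | inl v => exact hint v hx₀
    | inr b => exact hbd b hx₀
  funext x
  exact norm_le_zero_iff.mp ((hx₀ x).trans hzero.le)

theorem isUnit_diffusionMatrix [DecidableEq V] [DecidableEq B]
    (hB : ∀ b : B, ∃ v : V, Γ.Adj (Sum.inr b) (Sum.inl v))
    (hα : 0 < α₀) (ht : 0 ≤ t) (η : V → ℝ) (hη : ∀ v, 0 ≤ η v) :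
    IsUnit (diffusionMatrix Γ α₀ t (fun v => (η v : 𝕜))) := by
  rw [← Matrix.mulVec_injective_iff_isUnit]
  intro u w huw
  have h : Matrix.mulVec (diffusionMatrix Γ α₀ t (fun v => (η v : 𝕜))) (u - w) = 0 := by
    rw [Matrix.mulVec_sub, sub_eq_zero]; exact huw
  rw [diffusionMatrix_mulVec] at h
  exact sub_eq_zero.mp (diffusionOp_eq_zero Γ α₀ t hB hα ht η hη _ h)

/-- For a nonnegative potential, `u = greenMatrix η *ᵥ F` is the unique solution of the boundary
value problem with interior source and boundary data `F`. -/
theorem diffusionOp_eq_iff [DecidableEq V] [DecidableEq B]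
    (hB : ∀ b : B, ∃ v : V, Γ.Adj (Sum.inr b) (Sum.inl v))
    (hα : 0 < α₀) (ht : 0 ≤ t) (η : V → ℝ) (hη : ∀ v, 0 ≤ η v) (u F : V ⊕ B → 𝕜) :
    diffusionOp Γ α₀ t (fun v => (η v : 𝕜)) u = F ↔
      u = Matrix.mulVec (greenMatrix Γ α₀ t (fun v => (η v : 𝕜))) F := by
  have hdet : IsUnit (diffusionMatrix Γ α₀ t (fun v => (η v : 𝕜))).det :=
    (Matrix.isUnit_iff_isUnit_det _).mp (isUnit_diffusionMatrix Γ α₀ t hB hα ht η hη)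
  rw [← diffusionMatrix_mulVec, greenMatrix]
  constructor
  · rintro rfl
    rw [Matrix.mulVec_mulVec, Matrix.nonsing_inv_mul _ hdet, Matrix.one_mulVec]
  · rintro rfl
    rw [Matrix.mulVec_mulVec, Matrix.mul_nonsing_inv _ hdet, Matrix.one_mulVec]

end

open scoped NNReal Topology

/-! The forward Born series is a power series `P` without constant term whose linear term stretches
norms by at least `C` and whose term of order `j` has norm at most `ν μ^(j-1)`. Everything is
governed by the scalar function `m(ξ) = C ξ - ∑_{j ≥ 2} ν μ^(j-1) ξ^j`, which is concave on `[0,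
1/μ)`. Its derivative vanishes at `ρ_p`, and its maximum there is `r_p`; this is the origin of both
constants.

If `d ≤ m(ξ)`, the majorant of the formal inverse `Q`, evaluated at `d`, stays below `ξ`
(`sum_rightInv_le`). Hence `Q` has radius at least `r_p` and maps the ball of radius `r_p` into that
of radius `ρ_p`. Near `0` the sum of `P` composed with that of `Q` is the identity, and the identity
theorem extends this to the whole ball (`sum_rightInv_sum`). The resolvent identity shows that `P`
sums to the scattering data when `μ ‖η‖ < 1` (`forwardSeries_sum`). Since `Q` is the inverse Born
series (`toLp_inverseBorn`), this gives the second claim.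

For the first claim, apply the second to the data of `η`: the sum of the series is a potential in
the `ρ_p`-ball with the same data as `η`. The map `P.sum` is injective on that ball, because `m' >
0` there (`sum_injOn_of_born_bound`), so it remains to see that `η` lies in it. For nonnegative `η`
this follows by scaling: if `‖η‖ ≥ ρ_p`, some multiple `s η` with `s ≤ 1` has norm `ξ < ρ_p` with
`m(ξ) > ‖φ_η‖`. But `m(ξ)` is at most the norm of the data of `s η`, which by monotonicity of
Green's functions is at most `‖φ_η‖`, a contradiction. -/

/-- The lower bound `C x - ∑_{j ≥ 2} ν μ^(j-1) x^j`, in closed form, for the norm of a power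
series whose linear term is bounded below by `C` and whose `j`-th term is bounded by
`ν μ^(j-1)`. -/
noncomputable def bornMajorant (C μ ν x : ℝ) : ℝ :=
  C * x - ν * (μ * x ^ 2 / (1 - μ * x))

/-! ### The scalar majorant: its critical point and maximum. -/

section Scalar

variable {C μ ν : ℝ}

theorem potentialRadius_pos (hC : 0 < C) (hμ : 0 < μ) (hν : 0 < ν) :
    0 < potentialRadius C μ ν := by
  have h1 : 1 < √(1 + C / ν) := by
    rw [Real.lt_sqrt (by norm_num)]
    have := div_pos hC hν
    linarith
  have h2 : 1 / √(1 + C / ν) < 1 := by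
    rw [div_lt_one (by linarith)]; exact h1
  unfold potentialRadius
  have : 0 < 1 / μ := by positivity
  exact mul_pos this (by linarith)

theorem one_sub_mul_potentialRadius (hμ : 0 < μ) :
    1 - μ * potentialRadius C μ ν = 1 / √(1 + C / ν) := by
  unfold potentialRadius
  field_simp
  ring

theorem one_div_sqrt_lt_of_lt_potentialRadius (hμ : 0 < μ) {x : ℝ}
    (hx : x < potentialRadius C μ ν) : 1 / √(1 + C / ν) < 1 - μ * x := by
  rw [← one_sub_mul_potentialRadius hμ]
  nlinarith

theorem mul_lt_one_of_le_potentialRadius (hC : 0 < C) (hμ : 0 < μ) (hν : 0 < ν) {x : ℝ}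
    (hx : x ≤ potentialRadius C μ ν) : μ * x < 1 := by
  have h1 := one_sub_mul_potentialRadius (C := C) (ν := ν) hμ
  have h2 : 0 < 1 / √(1 + C / ν) := by positivity
  nlinarith

/-- With `z = √(1 + C/ν)` one has `C = ν (z² - 1)`, and both sides become rational functions of `z`,
`μ`, `ν`. -/
theorem bornMajorant_potentialRadius (hC : 0 < C) (hμ : 0 < μ) (hν : 0 < ν) :
    bornMajorant C μ ν (potentialRadius C μ ν) = bornRadius C μ ν := by
  unfold bornMajorant
  rw [one_sub_mul_potentialRadius hμ]
  unfold potentialRadius bornRadius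
  set z := √(1 + C / ν) with hz
  have hz0 : 0 < z := by positivity
  have hz2 : C = ν * (z ^ 2 - 1) := by
    rw [hz, Real.sq_sqrt (by positivity)]; field_simp; ring
  have hC' : z ^ 2 - 1 ≠ 0 := by
    intro h; rw [h] at hz2; simp at hz2; exact hC.ne' hz2
  clear_value z
  subst hz2
  field_simp
  ring

/-- This says that the derivative of `bornMajorant` is positive to the left of its critical point.
-/
theorem deriv_bound_of_lt_potentialRadius (hC : 0 < C) (hμ : 0 < μ) (hν : 0 < ν) {x : ℝ}
    (hx : x < potentialRadius C μ ν) : ν * (1 / (1 - μ * x) ^ 2 - 1) < C := by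
  have h1 := one_div_sqrt_lt_of_lt_potentialRadius hμ hx
  have h2 : 0 < 1 / √(1 + C / ν) := by positivity
  have h3 : (1 / √(1 + C / ν)) ^ 2 < (1 - μ * x) ^ 2 := by gcongr
  have h4 : 1 / (1 - μ * x) ^ 2 < 1 / (1 / √(1 + C / ν)) ^ 2 :=
    one_div_lt_one_div_of_lt (by positivity) h3
  rw [div_pow, Real.sq_sqrt (by positivity)] at h4
  have h5 : 1 / (1 - μ * x) ^ 2 - 1 < C / ν := by
    simp at h4 ⊢; linarith
  calc _ < ν * (C / ν) := by gcongr
    _ = C := by field_simp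

/-- Continuity at the maximum turns the strict inequality for the data into a point strictly inside
the ball; this slack is what later yields strict bounds on potentials. -/
theorem exists_lt_bornMajorant (hC : 0 < C) (hμ : 0 < μ) (hν : 0 < ν) {d : ℝ}
    (hd : d < bornRadius C μ ν) :
    ∃ ξ, 0 < ξ ∧ ξ < potentialRadius C μ ν ∧ d < bornMajorant C μ ν ξ := by
  have hρ := potentialRadius_pos hC hμ hν
  have h1 := mul_lt_one_of_le_potentialRadius hC hμ hν le_rfl
  have hcont : ContinuousAt (bornMajorant C μ ν) (potentialRadius C μ ν) := by
    unfold bornMajorant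
    have : 1 - μ * potentialRadius C μ ν ≠ 0 := by linarith
    fun_prop (disch := assumption)
  rw [← bornMajorant_potentialRadius hC hμ hν] at hd
  have h2 : ∀ᶠ x in 𝓝[<] (potentialRadius C μ ν), d < bornMajorant C μ ν x :=
    (hcont.eventually (lt_mem_nhds hd)).filter_mono nhdsWithin_le_nhds
  have h3 : ∀ᶠ x in 𝓝[<] (potentialRadius C μ ν), 0 < x :=
    (lt_mem_nhds hρ).filter_mono nhdsWithin_le_nhds
  obtain ⟨ξ, ⟨h4, h5⟩, h6⟩ := ((h2.and h3).and self_mem_nhdsWithin).exists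
  exact ⟨ξ, h5, h6, h4⟩

theorem sum_Ico_two_pow_le {x : ℝ} (hx : 0 ≤ x) (hx1 : x < 1) (n : ℕ) :
    ∑ k ∈ Finset.Ico 2 n, x ^ k ≤ x ^ 2 / (1 - x) := by
  have h : ∑ k ∈ Finset.Ico 2 n, x ^ k = x ^ 2 * ∑ k ∈ Finset.range (n - 2), x ^ k := by
    rw [Finset.sum_Ico_eq_sum_range, Finset.mul_sum]
    exact Finset.sum_congr rfl fun k _ => pow_add _ _ _
  rw [h, div_eq_mul_inv, ← tsum_geometric_of_lt_one hx hx1]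
  gcongr
  exact (summable_geometric_of_lt_one hx hx1).sum_le_tsum _ fun _ _ => by positivity

theorem hasSum_succ_mul_geometric {x : ℝ} (hx : 0 ≤ x) (hx1 : x < 1) :
    HasSum (fun n : ℕ => ((n : ℝ) + 1) * x ^ n) (1 / (1 - x) ^ 2) := by
  have hx' : ‖x‖ < 1 := by rwa [Real.norm_of_nonneg hx]
  have h := (hasSum_coe_mul_geometric_of_norm_lt_one hx').add (hasSum_geometric_of_lt_one hx hx1)
  have h1 : 1 - x ≠ 0 := by linarith
  have h2 : x / (1 - x) ^ 2 + (1 - x)⁻¹ = 1 / (1 - x) ^ 2 := by field_simp; ring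
  rw [h2] at h
  exact h.congr_fun fun n => by ring

end Scalar

/-! ### Inversion of power series with geometric coefficient bounds. -/

section Analytic

variable {𝕜 : Type*} [RCLike 𝕜] {E F : Type*} [NormedAddCommGroup E] [NormedSpace 𝕜 E]
  [NormedAddCommGroup F] [NormedSpace 𝕜 F] {P : FormalMultilinearSeries 𝕜 E F} {C μ ν : ℝ}

namespace FormalMultilinearSeries

/-- The bound is recast uniformly in `n`, order `0` included, as the majorant estimate for formal
inverses requires. -/
theorem norm_le_of_born_bound (hμ : 0 < μ) (hν : 0 < ν) (hP0 : P 0 = 0)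
    (hP : ∀ n, ‖P (n + 1)‖ ≤ ν * μ ^ n) (n : ℕ) : ‖P n‖ ≤ ν / μ * μ ^ n := by
  cases n with
  | zero => rw [hP0, norm_zero]; positivity
  | succ n =>
    refine (hP n).trans_eq ?_
    rw [pow_succ]; field_simp

theorem le_radius_of_born_bound (hμ : 0 < μ) (hν : 0 < ν) (hP0 : P 0 = 0)
    (hP : ∀ n, ‖P (n + 1)‖ ≤ ν * μ ^ n) : ENNReal.ofReal (1 / μ) ≤ P.radius := by
  refine P.le_radius_of_bound (ν / μ) fun n => ?_
  rw [Real.coe_toNNReal _ (by positivity)]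
  calc _ ≤ ν / μ * μ ^ n * (1 / μ) ^ n := by
        gcongr; exact norm_le_of_born_bound hμ hν hP0 hP n
    _ = ν / μ := by rw [mul_assoc, ← mul_pow, mul_one_div_cancel hμ.ne', one_pow, mul_one]

theorem mem_eball_of_mul_norm_lt_one (hμ : 0 < μ) {x : E} (hx : μ * ‖x‖ < 1) :
    x ∈ Metric.eball (0 : E) (ENNReal.ofReal (1 / μ)) := by
  rw [Metric.eball_ofReal, mem_ball_zero_iff, lt_div_iff₀ hμ]
  linarith

theorem hasSum_of_born_bound [CompleteSpace F] (hμ : 0 < μ) (hν : 0 < ν) (hP0 : P 0 = 0)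
    (hP : ∀ n, ‖P (n + 1)‖ ≤ ν * μ ^ n) {x : E} (hx : μ * ‖x‖ < 1) :
    HasSum (fun n => P (n + 1) fun _ => x) (P.sum x) := by
  have h := P.hasSum (Metric.eball_subset_eball (le_radius_of_born_bound hμ hν hP0 hP)
    (mem_eball_of_mul_norm_lt_one hμ hx))
  rw [← hasSum_nat_add_iff' 1] at h
  simpa [hP0] using h

/-- Injectivity of the sum on the ball where the derivative of the majorant is positive. -/
theorem sum_injOn_of_born_bound [CompleteSpace F] (hC : 0 < C) (hμ : 0 < μ) (hν : 0 < ν)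
    (hP0 : P 0 = 0) (hP : ∀ n, ‖P (n + 1)‖ ≤ ν * μ ^ n)
    (hlow : ∀ x : E, C * ‖x‖ ≤ ‖P 1 fun _ => x‖) :
    Set.InjOn P.sum (Metric.ball 0 (potentialRadius C μ ν)) := by
  intro x hx y hy hxy
  rw [mem_ball_zero_iff] at hx hy
  by_contra hne
  have hpos : 0 < ‖x - y‖ := norm_pos_iff.mpr (sub_ne_zero.mpr hne)
  set m := max ‖x‖ ‖y‖ with hm
  have hmρ : m < potentialRadius C μ ν := max_lt hx hy
  have hm0 : 0 ≤ m := (norm_nonneg x).trans (le_max_left _ _)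
  have hμm : μ * m < 1 := mul_lt_one_of_le_potentialRadius hC hμ hν hmρ.le
  have hsx := hasSum_of_born_bound hμ hν hP0 hP
    ((mul_le_mul_of_nonneg_left (le_max_left ‖x‖ ‖y‖) hμ.le).trans_lt hμm)
  have hsy := hasSum_of_born_bound hμ hν hP0 hP
    ((mul_le_mul_of_nonneg_left (le_max_right ‖x‖ ‖y‖) hμ.le).trans_lt hμm)
  have hs := hsx.sub hsy
  rw [hxy, sub_self, ← hasSum_nat_add_iff' 1] at hs
  have hone : (P 1 fun _ => x) - (P 1 fun _ => y) = P 1 fun _ => x - y := by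
    have := (P 1).toMultilinearMap.map_update_sub (fun _ => x) 0 x y
    simp only [Function.update_eq_const_of_subsingleton] at this
    exact this.symm
  simp only [Finset.range_one, Finset.sum_singleton, hone, zero_sub] at hs
  -- The factor `n + 1` is the Lipschitz factor of the term of order `n + 1`. Removing `n = 0`, the
  -- linear term, leaves `1 / (1 - μ m)² - 1`.
  have hg := hasSum_succ_mul_geometric (mul_nonneg hμ.le hm0) hμm
  rw [← hasSum_nat_add_iff' 1] at hg
  simp only [Finset.range_one, Finset.sum_singleton, Nat.cast_zero, zero_add, pow_zero,
    mul_one] at hg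
  have hle := tsum_of_norm_bounded
    (f := fun n => (P (n + 1 + 1) fun _ => x) - P (n + 1 + 1) fun _ => y) (hg.mul_left (ν * ‖x - y‖)) (fun n => by
    refine ((P (n + 1 + 1)).norm_image_sub_le _ _).trans ?_
    have hsub : ((fun _ : Fin (n + 1 + 1) => x) - fun _ => y) = fun _ => x - y := rfl
    rw [hsub, pi_norm_const, pi_norm_const, pi_norm_const, ← hm, Fintype.card_fin,
      Nat.add_sub_cancel]
    calc _ ≤ ν * μ ^ (n + 1) * ((n + 1 + 1 : ℕ) : ℝ) * m ^ (n + 1) * ‖x - y‖ := by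
          gcongr; exact hP _
      _ = _ := by rw [mul_pow]; push_cast; ring)
  rw [hs.tsum_eq, norm_neg] at hle
  have h1 := (hlow (x - y)).trans hle
  have h2 := deriv_bound_of_lt_potentialRadius hC hμ hν hmρ
  have h3 : C ≤ ν * (1 / (1 - μ * m) ^ 2 - 1) :=
    le_of_mul_le_mul_right (by linarith) hpos
  linarith

/-- Reverse triangle inequality: the linear term is at least `C ‖x‖` and the tail is dominated by a
geometric series. -/
theorem bornMajorant_le_norm_sum [CompleteSpace F] (hμ : 0 < μ) (hν : 0 < ν)
    (hP0 : P 0 = 0) (hP : ∀ n, ‖P (n + 1)‖ ≤ ν * μ ^ n)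
    (hlow : ∀ x : E, C * ‖x‖ ≤ ‖P 1 fun _ => x‖) {x : E} (hx : μ * ‖x‖ < 1) :
    bornMajorant C μ ν ‖x‖ ≤ ‖P.sum x‖ := by
  have hs := hasSum_of_born_bound hμ hν hP0 hP hx
  rw [← hasSum_nat_add_iff' 1] at hs
  simp only [Finset.range_one, Finset.sum_singleton] at hs
  have hg := (hasSum_geometric_of_lt_one (mul_nonneg hμ.le (norm_nonneg x)) hx).mul_left
    (ν * μ * ‖x‖ ^ 2)
  have hle := tsum_of_norm_bounded (f := fun n => P (n + 1 + 1) fun _ => x) hg (fun n => by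
    refine ((P (n + 1 + 1)).le_opNorm _).trans ?_
    rw [Finset.prod_const, Finset.card_univ, Fintype.card_fin]
    calc _ ≤ ν * μ ^ (n + 1) * ‖x‖ ^ (n + 1 + 1) := by gcongr; exact hP _
      _ = _ := by rw [mul_pow]; ring)
  rw [hs.tsum_eq] at hle
  have h1 := norm_sub_norm_le (P 1 fun _ => x) (P.sum x)
  rw [norm_sub_rev] at h1
  have h2 := hlow x
  have h3 : ν * μ * ‖x‖ ^ 2 * (1 - μ * ‖x‖)⁻¹ = ν * (μ * ‖x‖ ^ 2 / (1 - μ * ‖x‖)) := by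
    rw [div_eq_mul_inv]; ring
  unfold bornMajorant
  linarith

/-- The majorant series of the inverse stays below `ξ` as soon as the argument is at most
`bornMajorant C μ ν ξ`. -/
theorem sum_rightInv_le (hC : 0 < C) (hμ : 0 < μ) (hν : 0 < ν)
    (hP0 : P 0 = 0) (hP : ∀ n, ‖P (n + 1)‖ ≤ ν * μ ^ n) (i : E ≃L[𝕜] F)
    (hlow : ∀ x : E, C * ‖x‖ ≤ ‖i x‖) {d ξ : ℝ} (hd : 0 ≤ d) (hξ : 0 ≤ ξ) (hξ1 : μ * ξ < 1)
    (hdξ : d ≤ bornMajorant C μ ν ξ) (n : ℕ) :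
    ∑ k ∈ Finset.Ico 1 (n + 1), d ^ k * ‖P.rightInv i 0 k‖ ≤ ξ := by
  have hi : ‖(i.symm : F →L[𝕜] E)‖ ≤ 1 / C := by
    refine ContinuousLinearMap.opNorm_le_bound _ (by positivity) fun y => ?_
    have := hlow (i.symm y)
    rw [ContinuousLinearEquiv.apply_symm_apply] at this
    rw [one_div, inv_mul_eq_div, le_div_iff₀ hC]
    simpa [mul_comm] using this
  induction n with
  | zero => simpa using hξ
  | succ n ih =>
    have hs0 : 0 ≤ ∑ k ∈ Finset.Ico 1 (n + 1), d ^ k * ‖P.rightInv i 0 k‖ :=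
      Finset.sum_nonneg fun _ _ => by positivity
    -- The recursion bounds the new partial sum by `1/C` times `d` plus the nonlinear majorant
    -- evaluated at the previous partial sum. With the latter at most `ξ`, the condition to stay
    -- below `ξ` is exactly `d ≤ bornMajorant C μ ν ξ`.
    refine (radius_rightInv_pos_of_radius_pos_aux2 (by omega) P i hμ.le hd
      (C := ν / μ) (by positivity) (norm_le_of_born_bound hμ hν hP0 hP)).trans ?_
    have hsum : ∑ k ∈ Finset.Ico 2 (n + 1 + 1),
        (μ * ∑ j ∈ Finset.Ico 1 (n + 1), d ^ j * ‖P.rightInv i 0 j‖) ^ k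
          ≤ (μ * ξ) ^ 2 / (1 - μ * ξ) :=
      (Finset.sum_le_sum fun k _ => by gcongr).trans
        (sum_Ico_two_pow_le (by positivity) hξ1 _)
    have h1 : 0 < 1 - μ * ξ := by linarith
    calc _ ≤ 1 / C * d + 1 / C * (ν / μ) * ((μ * ξ) ^ 2 / (1 - μ * ξ)) := by gcongr
      _ = (d + ν * (μ * ξ ^ 2 / (1 - μ * ξ))) / C := by field_simp
      _ ≤ ξ := by
        rw [div_le_iff₀ hC]
        unfold bornMajorant at hdξ
        linarith

theorem summable_rightInv (hC : 0 < C) (hμ : 0 < μ) (hν : 0 < ν)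
    (hP0 : P 0 = 0) (hP : ∀ n, ‖P (n + 1)‖ ≤ ν * μ ^ n) (i : E ≃L[𝕜] F)
    (hlow : ∀ x : E, C * ‖x‖ ≤ ‖i x‖) {d ξ : ℝ} (hd : 0 ≤ d) (hξ : 0 ≤ ξ) (hξ1 : μ * ξ < 1)
    (hdξ : d ≤ bornMajorant C μ ν ξ) :
    Summable (fun n => ‖P.rightInv i 0 n‖ * d ^ n) ∧
      ∑' n, ‖P.rightInv i 0 n‖ * d ^ n ≤ ξ := by
  have h0 : ∀ n, 0 ≤ ‖P.rightInv i 0 n‖ * d ^ n := fun n => by positivity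
  have hb : ∀ n, ∑ k ∈ Finset.range n, ‖P.rightInv i 0 k‖ * d ^ k ≤ ξ := by
    intro n
    cases n with
    | zero => simpa using hξ
    | succ n =>
      refine le_trans (le_of_eq ?_) (sum_rightInv_le hC hμ hν hP0 hP i hlow hd hξ hξ1 hdξ n)
      rw [Finset.range_eq_Ico, Finset.sum_eq_sum_Ico_succ_bot (by omega)]
      simp [mul_comm]
  exact ⟨summable_of_sum_range_le h0 hb, Real.tsum_le_of_sum_range_le h0 hb⟩

theorem le_radius_rightInv (hC : 0 < C) (hμ : 0 < μ) (hν : 0 < ν)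
    (hP0 : P 0 = 0) (hP : ∀ n, ‖P (n + 1)‖ ≤ ν * μ ^ n) (i : E ≃L[𝕜] F)
    (hlow : ∀ x : E, C * ‖x‖ ≤ ‖i x‖) :
    ENNReal.ofReal (bornRadius C μ ν) ≤ (P.rightInv i 0).radius := by
  refine ENNReal.le_of_forall_nnreal_lt fun d hd => ?_
  have hd' : (d : ℝ) < bornRadius C μ ν := by
    rw [← ENNReal.ofReal_coe_nnreal] at hd
    exact (ENNReal.ofReal_lt_ofReal_iff_of_nonneg d.2).mp hd
  obtain ⟨ξ, hξ, hξρ, hdξ⟩ := exists_lt_bornMajorant hC hμ hν hd'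
  exact le_radius_of_summable_norm _ (summable_rightInv hC hμ hν hP0 hP i hlow d.2 hξ.le
    (mul_lt_one_of_le_potentialRadius hC hμ hν hξρ.le) hdξ.le).1

theorem norm_rightInv_sum_lt (hC : 0 < C) (hμ : 0 < μ) (hν : 0 < ν)
    (hP0 : P 0 = 0) (hP : ∀ n, ‖P (n + 1)‖ ≤ ν * μ ^ n) (i : E ≃L[𝕜] F)
    (hlow : ∀ x : E, C * ‖x‖ ≤ ‖i x‖) {y : F} (hy : ‖y‖ < bornRadius C μ ν) :
    ‖(P.rightInv i 0).sum y‖ < potentialRadius C μ ν := by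
  obtain ⟨ξ, hξ, hξρ, hdξ⟩ := exists_lt_bornMajorant hC hμ hν hy
  obtain ⟨hs, hle⟩ := summable_rightInv hC hμ hν hP0 hP i hlow (norm_nonneg y) hξ.le
    (mul_lt_one_of_le_potentialRadius hC hμ hν hξρ.le) hdξ.le
  refine lt_of_le_of_lt ?_ hξρ
  refine (tsum_of_norm_bounded hs.hasSum fun n => ?_).trans hle
  refine ((P.rightInv i 0 n).le_opNorm _).trans_eq ?_
  rw [Finset.prod_const, Finset.card_univ, Fintype.card_fin]

theorem hasSum_rightInv [CompleteSpace E] (hC : 0 < C) (hμ : 0 < μ) (hν : 0 < ν)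
    (hP0 : P 0 = 0) (hP : ∀ n, ‖P (n + 1)‖ ≤ ν * μ ^ n) (i : E ≃L[𝕜] F)
    (hlow : ∀ x : E, C * ‖x‖ ≤ ‖i x‖) {y : F} (hy : ‖y‖ < bornRadius C μ ν) :
    HasSum (fun n => P.rightInv i 0 (n + 1) fun _ => y) ((P.rightInv i 0).sum y) := by
  have hmem : y ∈ Metric.eball (0 : F) (ENNReal.ofReal (bornRadius C μ ν)) := by
    rwa [Metric.eball_ofReal, mem_ball_zero_iff]
  have h := (P.rightInv i 0).hasSum
    (Metric.eball_subset_eball (le_radius_rightInv hC hμ hν hP0 hP i hlow) hmem)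
  rw [← hasSum_nat_add_iff' 1] at h
  simpa using h

/-- The formal identity only gives equality near `0`. Since the inverse series maps the ball into
the domain of convergence of `P`, the composite is analytic on the whole ball and the identity
theorem applies. -/
theorem sum_rightInv_sum [CompleteSpace E] [CompleteSpace F] (hC : 0 < C) (hμ : 0 < μ) (hν : 0 < ν)
    (hP0 : P 0 = 0) (hP : ∀ n, ‖P (n + 1)‖ ≤ ν * μ ^ n) (i : E ≃L[𝕜] F)
    (hP1 : P 1 = (continuousMultilinearCurryFin1 𝕜 E F).symm i)
    (hlow : ∀ x : E, C * ‖x‖ ≤ ‖i x‖) {y : F} (hy : ‖y‖ < bornRadius C μ ν) :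
    P.sum ((P.rightInv i 0).sum y) = y := by
  set Q := P.rightInv i 0 with hQ
  have hr : 0 < bornRadius C μ ν := (norm_nonneg y).trans_lt hy
  have hμ' : 0 < 1 / μ := by positivity
  have hPr := le_radius_of_born_bound hμ hν hP0 hP
  have hQr := le_radius_rightInv hC hμ hν hP0 hP i hlow
  have hPs : HasFPowerSeriesOnBall P.sum P 0 P.radius :=
    P.hasFPowerSeriesOnBall ((ENNReal.ofReal_pos.mpr hμ').trans_le hPr)
  have hQs : HasFPowerSeriesOnBall Q.sum Q 0 Q.radius :=
    Q.hasFPowerSeriesOnBall ((ENNReal.ofReal_pos.mpr hr).trans_le hQr)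
  have hQ0 : Q.sum 0 = 0 := by
    have := hQs.coeff_zero fun _ => 0
    rw [← this, hQ]; simp
  have hball : ∀ z ∈ Metric.ball (0 : F) (bornRadius C μ ν),
      z ∈ Metric.eball (0 : F) Q.radius := fun z hz =>
    Metric.eball_subset_eball hQr (by rwa [Metric.eball_ofReal])
  have han : AnalyticOnNhd 𝕜 (P.sum ∘ Q.sum) (Metric.ball (0 : F) (bornRadius C μ ν)) := by
    intro z hz
    refine AnalyticAt.comp ?_ (hQs.analyticOnNhd z (hball z hz))
    refine hPs.analyticOnNhd _ (Metric.eball_subset_eball hPr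
      (mem_eball_of_mul_norm_lt_one hμ ?_))
    exact mul_lt_one_of_le_potentialRadius hC hμ hν
      (norm_rightInv_sum_lt hC hμ hν hP0 hP i hlow (mem_ball_zero_iff.mp hz)).le
  have hid : AnalyticOnNhd 𝕜 (_root_.id : F → F) (Metric.ball (0 : F) (bornRadius C μ ν)) :=
    fun z _ => analyticAt_id
  have hloc : P.sum ∘ Q.sum =ᶠ[𝓝 0] _root_.id := by
    have h1 : HasFPowerSeriesAt (P.sum ∘ Q.sum) (P.comp Q) 0 := by
      refine HasFPowerSeriesAt.comp ?_ hQs.hasFPowerSeriesAt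
      rw [hQ0]; exact hPs.hasFPowerSeriesAt
    have h2 : HasFPowerSeriesAt (_root_.id : F → F) (P.comp Q) 0 := by
      rw [hQ, comp_rightInv P i 0 hP1, hP0]
      exact (ContinuousLinearMap.id 𝕜 F).hasFPowerSeriesAt 0
    have h3 := h1.eventually_hasSum
    have h4 := h2.eventually_hasSum
    filter_upwards [h3, h4] with z hz hz'
    have := hz.unique hz'
    simpa using this
  -- A real structure is needed to get connectedness of the ball from convexity.
  let _ : NormedSpace ℝ F := NormedSpace.restrictScalars ℝ 𝕜 F
  exact han.eqOn_of_preconnected_of_eventuallyEq hid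
    (convex_ball (0 : F) (bornRadius C μ ν)).isPreconnected (Metric.mem_ball_self hr) hloc
    (mem_ball_zero_iff.mpr hy)

end FormalMultilinearSeries

end Analytic

/-! ### Finite `ℓ^p` norms and Hölder's inequality. -/

section LpNorm

variable {ι κ E : Type*} [Fintype ι] [Fintype κ] [NormedAddCommGroup E]

theorem lpNorm_nonneg {p : ENNReal} (hp : 1 ≤ p) (x : ι → E) : 0 ≤ lpNorm p x := by
  have : Fact (1 ≤ p) := ⟨hp⟩
  exact norm_nonneg (WithLp.toLp p x)

theorem norm_le_lpNorm {p : ENNReal} (hp : 1 ≤ p) (x : ι → E) (i : ι) : ‖x i‖ ≤ lpNorm p x := by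
  have : Fact (1 ≤ p) := ⟨hp⟩
  exact PiLp.norm_apply_le (WithLp.toLp p x) i

theorem lpNorm_top (x : ι → E) : lpNorm ⊤ x = ⨆ i, ‖x i‖ :=
  PiLp.norm_eq_ciSup (WithLp.toLp ⊤ x)

theorem lpNorm_eq_sum {p : ENNReal} (hp : 1 ≤ p) (hp' : p ≠ ⊤) (x : ι → E) :
    lpNorm p x = (∑ i, ‖x i‖ ^ p.toReal) ^ (1 / p.toReal) :=
  PiLp.norm_eq_sum (ENNReal.toReal_pos (by positivity) hp') (WithLp.toLp p x)

theorem lpNorm_one (x : ι → E) : lpNorm 1 x = ∑ i, ‖x i‖ := by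
  rw [lpNorm_eq_sum le_rfl ENNReal.one_ne_top]; simp

theorem lpNorm_mono {F : Type*} [NormedAddCommGroup F] {p : ENNReal} (hp : 1 ≤ p)
    {x : ι → E} {y : ι → F} (h : ∀ i, ‖x i‖ ≤ ‖y i‖) : lpNorm p x ≤ lpNorm p y := by
  by_cases hp' : p = ⊤
  · subst hp'
    rw [lpNorm_top]
    exact Real.iSup_le (fun i => (h i).trans (norm_le_lpNorm le_top y i)) (lpNorm_nonneg le_top y)
  · rw [lpNorm_eq_sum hp hp', lpNorm_eq_sum hp hp']
    gcongr
    exact h _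

theorem lpNorm_smul {𝕜 : Type*} [RCLike 𝕜] [NormedSpace 𝕜 E] {p : ENNReal} (hp : 1 ≤ p) (c : 𝕜)
    (x : ι → E) : lpNorm p (fun i => c • x i) = ‖c‖ * lpNorm p x := by
  have : Fact (1 ≤ p) := ⟨hp⟩
  exact norm_smul c (WithLp.toLp p x)

theorem lpNorm_mul_prod {p : ENNReal} (hp : 1 ≤ p) (a : ι → ℝ) (b : κ → ℝ) :
    lpNorm p (fun x : ι × κ => a x.1 * b x.2) ≤ lpNorm p a * lpNorm p b := by
  by_cases hp' : p = ⊤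
  · subst hp'
    rw [lpNorm_top]
    refine Real.iSup_le (fun x => ?_)
      (mul_nonneg (lpNorm_nonneg le_top a) (lpNorm_nonneg le_top b))
    rw [norm_mul]
    exact mul_le_mul (norm_le_lpNorm le_top a _) (norm_le_lpNorm le_top b _) (norm_nonneg _)
      (lpNorm_nonneg le_top a)
  · rw [lpNorm_eq_sum hp hp', lpNorm_eq_sum hp hp', lpNorm_eq_sum hp hp',
      ← Real.mul_rpow (by positivity) (by positivity), Finset.sum_mul_sum,
      Fintype.sum_prod_type]
    refine le_of_eq ?_
    congr 1
    refine Finset.sum_congr rfl fun i _ => Finset.sum_congr rfl fun j _ => ?_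
    rw [norm_mul, Real.mul_rpow (norm_nonneg _) (norm_nonneg _)]

/-- Hölder's inequality for finite sums, including the endpoint exponents. -/
theorem sum_norm_mul_norm_le {F : Type*} [NormedAddCommGroup F] {p q : ENNReal}
    (hpq : p.HolderConjugate q) (x : ι → E) (y : ι → F) :
    ∑ i, ‖x i‖ * ‖y i‖ ≤ lpNorm p x * lpNorm q y := by
  have hp : 1 ≤ p := ENNReal.HolderConjugate.one_le p q
  have hqp : q.HolderConjugate p := ENNReal.HolderTriple.symm
  have hq : 1 ≤ q := ENNReal.HolderConjugate.one_le q p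
  have hone : (1 : ENNReal).HolderConjugate ⊤ := inferInstance
  have htop : (⊤ : ENNReal).HolderConjugate 1 := inferInstance
  by_cases hp' : p = ⊤
  · subst hp'
    obtain rfl : q = 1 := ENNReal.HolderConjugate.unique ⊤ q 1
    rw [lpNorm_one, Finset.mul_sum]
    gcongr
    exact norm_le_lpNorm le_top x _
  by_cases hq' : q = ⊤
  · subst hq'
    obtain rfl : p = 1 := ENNReal.HolderConjugate.unique ⊤ p 1
    rw [lpNorm_one, Finset.sum_mul]
    gcongr
    exact norm_le_lpNorm le_top y _
  rw [lpNorm_eq_sum hp hp', lpNorm_eq_sum hq hq']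
  exact Real.inner_le_Lp_mul_Lq_of_nonneg _
    (ENNReal.HolderConjugate.toReal_of_ne_top hp' hq')
    (fun _ _ => norm_nonneg _) (fun _ _ => norm_nonneg _)

theorem norm_sum_mul_le {𝕜 : Type*} [RCLike 𝕜] {q : ENNReal} (hq : 1 ≤ q) (a x : ι → 𝕜) :
    ‖∑ v, a v * x v‖ ≤ lpNorm q a * ∑ v, ‖x v‖ := by
  rw [Finset.mul_sum]
  refine (norm_sum_le _ _).trans (Finset.sum_le_sum fun v _ => ?_)
  rw [norm_mul]
  gcongr
  exact norm_le_lpNorm hq a v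

end LpNorm

/-! ### Bounds in `ℓ¹` for products of diagonal matrices and Green's matrices. -/

section MatrixBound

variable {𝕜 : Type*} [RCLike 𝕜] {V : Type*} [Fintype V] [DecidableEq V] {p q : ENNReal}

theorem sum_norm_diagonal_mulVec_le (hpq : p.HolderConjugate q) (η y : V → 𝕜) :
    ∑ v, ‖(Matrix.diagonal η).mulVec y v‖ ≤ lpNorm p η * lpNorm q y := by
  simp only [Matrix.mulVec_diagonal, norm_mul]
  exact sum_norm_mul_norm_le hpq η y

/-- On `ℓ¹` the operator norm is the largest `ℓ¹` norm of a column; Hölder bounds the column `η w *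
G w v` by `‖η‖_p ‖G^{·;v}‖_q`. This is why `μ_p` is a maximum over columns. -/
theorem sum_norm_diagonal_mul_mulVec_le (hpq : p.HolderConjugate q) (G : Matrix V V 𝕜) {g : ℝ}
    (hG : ∀ v, lpNorm q (fun w => G w v) ≤ g) (η x : V → 𝕜) :
    ∑ v, ‖(Matrix.diagonal η * G).mulVec x v‖ ≤ lpNorm p η * g * ∑ v, ‖x v‖ := by
  have hp : 1 ≤ p := ENNReal.HolderConjugate.one_le p q
  calc _ ≤ ∑ w, ∑ v, ‖η w‖ * ‖G w v‖ * ‖x v‖ := by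
        refine Finset.sum_le_sum fun w _ => ?_
        rw [← Matrix.mulVec_mulVec, Matrix.mulVec_diagonal, norm_mul]
        simp only [mul_assoc, ← Finset.mul_sum]
        gcongr
        exact (norm_sum_le _ _).trans (Finset.sum_le_sum fun v _ => (norm_mul _ _).le)
    _ = ∑ v, (∑ w, ‖η w‖ * ‖G w v‖) * ‖x v‖ := by
        rw [Finset.sum_comm]; simp only [Finset.sum_mul]
    _ ≤ ∑ v, (lpNorm p η * g) * ‖x v‖ := by
        gcongr with v
        exact (sum_norm_mul_norm_le hpq η fun w => G w v).trans
          (mul_le_mul_of_nonneg_left (hG v) (lpNorm_nonneg hp η))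
    _ = _ := by rw [Finset.mul_sum]

theorem sum_norm_diagonal_mul_prod_mulVec_le (hpq : p.HolderConjugate q) (G : Matrix V V 𝕜)
    {g : ℝ} (hg : 0 ≤ g) (hG : ∀ v, lpNorm q (fun w => G w v) ≤ g) (y : V → 𝕜) (n : ℕ)
    (η : Fin (n + 1) → V → 𝕜) :
    ∑ v, ‖(Matrix.diagonal (η 0)
        * (List.ofFn fun i : Fin n => G * Matrix.diagonal (η i.succ)).prod).mulVec y v‖
      ≤ g ^ n * (∏ i, lpNorm p (η i)) * lpNorm q y := by
  have hp : 1 ≤ p := ENNReal.HolderConjugate.one_le p q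
  induction n with
  | zero => simpa using sum_norm_diagonal_mulVec_le hpq (η 0) y
  | succ n ih =>
    have h := ih fun i => η i.succ
    -- Regrouping as `(D_{η₀} G) (D_{η₁} ⋯)` peels off one factor bounded on `ℓ¹`; only the
    -- innermost diagonal takes `ℓ^q` to `ℓ¹`.
    rw [List.ofFn_succ, List.prod_cons, mul_assoc G, ← mul_assoc, ← Matrix.mulVec_mulVec,
      Fin.prod_univ_succ]
    refine (sum_norm_diagonal_mul_mulVec_le hpq G hG _ _).trans ?_
    calc _ ≤ lpNorm p (η 0) * g
          * (g ^ n * (∏ i : Fin (n + 1), lpNorm p (η i.succ)) * lpNorm q y) := by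
          gcongr
          exact mul_nonneg (lpNorm_nonneg hp _) hg
      _ = _ := by ring

end MatrixBound

/-! ### The forward Born series as a formal multilinear series, and its formal inverse. -/

section ForwardSeries

variable {V B : Type*} [Fintype V] [Fintype B]
  (Γ : SimpleGraph (V ⊕ B)) [DecidableRel Γ.Adj] (α₀ t : ℝ) [DecidableEq V] [DecidableEq B]
  (R S : Finset B) (𝕜 : Type*) [RCLike 𝕜]

/-- `max_{v ∈ V} ‖G₀^{V;v}‖_{ℓ^q(V)}`, so that `μ_p = α₀ * greenColumnMax`. -/
noncomputable def greenColumnMax (q : ENNReal) : ℝ :=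
  ⨆ v : V, lpNorm q fun w => greenVV Γ α₀ t 𝕜 w v

variable {𝕜} {α₀}

theorem greenColumnMax_nonneg {q : ENNReal} (hq : 1 ≤ q) : 0 ≤ greenColumnMax Γ α₀ t 𝕜 q :=
  Real.iSup_nonneg fun _ => lpNorm_nonneg hq _

theorem lpNorm_greenVV_le (q : ENNReal) (v : V) :
    lpNorm q (fun w => greenVV Γ α₀ t 𝕜 w v) ≤ greenColumnMax Γ α₀ t 𝕜 q :=
  le_ciSup (f := fun v : V => lpNorm q fun w => greenVV Γ α₀ t 𝕜 w v)
    (Set.finite_range _).bddAbove v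

theorem muConst_nonneg (hα : 0 < α₀) {q : ENNReal} (hq : 1 ≤ q) : 0 ≤ muConst Γ α₀ t 𝕜 q :=
  mul_nonneg hα.le (greenColumnMax_nonneg Γ t hq)

theorem nuConst_nonneg (hα : 0 < α₀) {p : ENNReal} (hp : 1 ≤ p) (q : ENNReal) :
    0 ≤ nuConst Γ α₀ t R S 𝕜 p q :=
  mul_nonneg (mul_nonneg hα.le (lpNorm_nonneg hp _)) (lpNorm_nonneg hp _)

theorem forwardBorn_succ_apply (n : ℕ) (η : Fin (n + 1) → V → 𝕜) (rs : R × S) :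
    forwardBorn Γ α₀ t R S (n + 1) η rs = -(-(α₀ : 𝕜)) ^ (n + 1) *
      ∑ v, greenRV Γ α₀ t R 𝕜 rs.1 v * (Matrix.diagonal (η 0)
        * (List.ofFn fun i : Fin n => greenVV Γ α₀ t 𝕜 * Matrix.diagonal (η i.succ)).prod).mulVec
          (fun w => greenVS Γ α₀ t S 𝕜 w rs.2) v := by
  simp only [forwardBorn]
  rw [Matrix.mul_assoc (greenRV Γ α₀ t R 𝕜), Matrix.mul_assoc (greenRV Γ α₀ t R 𝕜)]
  rfl

/-- Each entry is bounded by a constant times `a(r) b(s)`, whose `ℓ^p` norm over `R × S` splits. Of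
the `n + 1` powers of `α₀`, one goes into `ν_p` and `n` into `μ_p ^ n`. -/
theorem lpNorm_forwardBorn_succ_le (hα : 0 < α₀) {p q : ENNReal} (hpq : p.HolderConjugate q)
    (n : ℕ) (η : Fin (n + 1) → V → 𝕜) :
    lpNorm p (forwardBorn Γ α₀ t R S (n + 1) η)
      ≤ nuConst Γ α₀ t R S 𝕜 p q * muConst Γ α₀ t 𝕜 q ^ n * ∏ i, lpNorm p (η i) := by
  have hp : 1 ≤ p := ENNReal.HolderConjugate.one_le p q
  have hqp : q.HolderConjugate p := ENNReal.HolderTriple.symm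
  have hq : 1 ≤ q := ENNReal.HolderConjugate.one_le q p
  set a : R → ℝ := fun r => lpNorm q fun v => greenRV Γ α₀ t R 𝕜 r v with ha
  set b : S → ℝ := fun s => lpNorm q fun v => greenVS Γ α₀ t S 𝕜 v s with hb
  set g := greenColumnMax Γ α₀ t 𝕜 q with hg
  have hg0 : 0 ≤ g := greenColumnMax_nonneg Γ t hq
  have hprod : 0 ≤ ∏ i, lpNorm p (η i) := Finset.prod_nonneg fun i _ => lpNorm_nonneg hp _
  have hc : 0 ≤ α₀ ^ (n + 1) * (g ^ n * ∏ i, lpNorm p (η i)) := by positivity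
  calc _ ≤ lpNorm p (fun rs : R × S =>
        (α₀ ^ (n + 1) * (g ^ n * ∏ i, lpNorm p (η i))) • (a rs.1 * b rs.2)) := by
        refine lpNorm_mono hp fun rs => ?_
        rw [forwardBorn_succ_apply, norm_mul, norm_neg, norm_pow, norm_neg, RCLike.norm_ofReal,
          abs_of_pos hα, smul_eq_mul, norm_mul, Real.norm_of_nonneg hc, norm_mul,
          Real.norm_of_nonneg (lpNorm_nonneg hq _), Real.norm_of_nonneg (lpNorm_nonneg hq _)]
        calc _ ≤ α₀ ^ (n + 1) * (a rs.1 * (g ^ n * (∏ i, lpNorm p (η i)) * b rs.2)) := by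
              gcongr
              refine (norm_sum_mul_le hq _ _).trans ?_
              refine mul_le_mul_of_nonneg_left ?_ (lpNorm_nonneg hq _)
              exact sum_norm_diagonal_mul_prod_mulVec_le hpq _ hg0
                (lpNorm_greenVV_le Γ t q) _ n η
          _ = _ := by ring
    _ = (α₀ ^ (n + 1) * (g ^ n * ∏ i, lpNorm p (η i)))
          * lpNorm p (fun rs : R × S => a rs.1 * b rs.2) := by
        rw [lpNorm_smul (𝕜 := ℝ) hp, Real.norm_of_nonneg hc]
    _ ≤ (α₀ ^ (n + 1) * (g ^ n * ∏ i, lpNorm p (η i))) * (lpNorm p a * lpNorm p b) := by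
        gcongr
        exact lpNorm_mul_prod hp a b
    _ = _ := by
        have hμ : muConst Γ α₀ t 𝕜 q = α₀ * g := rfl
        have hν : nuConst Γ α₀ t R S 𝕜 p q = α₀ * lpNorm p a * lpNorm p b := rfl
        rw [hμ, hν, mul_pow, pow_succ]
        ring

variable (𝕜) (α₀)

/-- The linear factors `η ↦ D_η` and `η ↦ G₀^{V;V} D_η` of the forward Born series. -/
noncomputable def bornFactor (p : ENNReal) (n : ℕ) :
    Fin (n + 1) → (PiLp p (fun _ : V => 𝕜) →ₗ[𝕜] Matrix V V 𝕜) :=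
  Fin.cons
    (Matrix.diagonalLinearMap V 𝕜 𝕜 ∘ₗ (WithLp.linearEquiv p 𝕜 (V → 𝕜)).toLinearMap)
    fun _ => LinearMap.mulLeft 𝕜 (greenVV Γ α₀ t 𝕜) ∘ₗ Matrix.diagonalLinearMap V 𝕜 𝕜
      ∘ₗ (WithLp.linearEquiv p 𝕜 (V → 𝕜)).toLinearMap

/-- The linear map completing a product of Born factors to a term of the forward series. -/
noncomputable def bornOuter (p : ENNReal) (n : ℕ) :
    Matrix V V 𝕜 →ₗ[𝕜] PiLp p (fun _ : R × S => 𝕜) where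
  toFun A := WithLp.toLp p fun rs => -(-(α₀ : 𝕜)) ^ (n + 1) *
    ∑ v, greenRV Γ α₀ t R 𝕜 rs.1 v * A.mulVec (fun w => greenVS Γ α₀ t S 𝕜 w rs.2) v
  map_add' A A' := by
    ext rs
    simp only [Matrix.add_mulVec, Pi.add_apply, mul_add, Finset.sum_add_distrib, PiLp.add_apply]
  map_smul' c A := by
    ext rs
    simp only [Matrix.smul_mulVec, Pi.smul_apply, smul_eq_mul, PiLp.smul_apply,
      RingHom.id_apply, Finset.mul_sum]
    exact Finset.sum_congr rfl fun v _ => by ring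

/-- The terms of the forward Born series as multilinear maps. -/
noncomputable def forwardMultilinear (p : ENNReal) (n : ℕ) :
    MultilinearMap 𝕜 (fun _ : Fin (n + 1) => PiLp p (fun _ : V => 𝕜))
      (PiLp p (fun _ : R × S => 𝕜)) :=
  (bornOuter Γ α₀ t R S 𝕜 p n).compMultilinearMap
    ((MultilinearMap.mkPiAlgebraFin 𝕜 (n + 1) (Matrix V V 𝕜)).compLinearMap
      (bornFactor Γ α₀ t 𝕜 p n))

theorem forwardMultilinear_apply (p : ENNReal) (n : ℕ)
    (η : Fin (n + 1) → PiLp p (fun _ : V => 𝕜)) :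
    forwardMultilinear Γ α₀ t R S 𝕜 p n η
      = WithLp.toLp p (forwardBorn Γ α₀ t R S (n + 1) fun i => (η i).ofLp) := by
  ext rs
  simp [forwardBorn_succ_apply, forwardMultilinear, bornOuter, bornFactor,
    MultilinearMap.mkPiAlgebraFin_apply, List.ofFn_succ]

variable {α₀}

/-- The forward Born series as a formal multilinear series. -/
noncomputable def forwardSeries (hα : 0 < α₀) (p q : ENNReal) [Fact (1 ≤ p)]
    [hpq : p.HolderConjugate q] :
    FormalMultilinearSeries 𝕜 (PiLp p (fun _ : V => 𝕜)) (PiLp p (fun _ : R × S => 𝕜))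
  | 0 => 0
  | n + 1 => (forwardMultilinear Γ α₀ t R S 𝕜 p n).mkContinuous
      (nuConst Γ α₀ t R S 𝕜 p q * muConst Γ α₀ t 𝕜 q ^ n) fun η => by
        rw [forwardMultilinear_apply]
        exact lpNorm_forwardBorn_succ_le Γ t R S hα hpq n _

variable (hα : 0 < α₀) (p q : ENNReal) [Fact (1 ≤ p)] [p.HolderConjugate q]

theorem forwardSeries_apply (n : ℕ) (η : Fin n → PiLp p (fun _ : V => 𝕜)) :
    forwardSeries Γ t R S 𝕜 hα p q n η
      = WithLp.toLp p (forwardBorn Γ α₀ t R S n fun i => (η i).ofLp) := by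
  cases n with
  | zero => rfl
  | succ n => exact forwardMultilinear_apply Γ α₀ t R S 𝕜 p n η

theorem norm_forwardSeries_succ_le (n : ℕ) :
    ‖forwardSeries Γ t R S 𝕜 hα p q (n + 1)‖
      ≤ nuConst Γ α₀ t R S 𝕜 p q * muConst Γ α₀ t 𝕜 q ^ n := by
  have hp : 1 ≤ p := Fact.out
  have hqp : q.HolderConjugate p := ENNReal.HolderTriple.symm
  have hq : 1 ≤ q := ENNReal.HolderConjugate.one_le q p
  exact MultilinearMap.mkContinuous_norm_le _
    (mul_nonneg (nuConst_nonneg Γ t R S hα hp q) (pow_nonneg (muConst_nonneg Γ t hα hq) n)) fun η => by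
      rw [forwardMultilinear_apply]
      exact lpNorm_forwardBorn_succ_le Γ t R S hα ‹_› n _

/-- The operators of the inverse Born series are those of the formal left inverse. -/
theorem toLp_inverseBorn (i : PiLp p (fun _ : V => 𝕜) ≃L[𝕜] PiLp p (fun _ : R × S => 𝕜))
    (T : (R × S → 𝕜) → (V → 𝕜)) (hT : ∀ φ, WithLp.toLp p (T φ) = i.symm (WithLp.toLp p φ))
    (j : ℕ) (φ : Fin j → R × S → 𝕜) :
    WithLp.toLp p (inverseBorn Γ α₀ t R S T j φ)
      = (forwardSeries Γ t R S 𝕜 hα p q).leftInv i 0 j fun k => WithLp.toLp p (φ k) := by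
  induction j using Nat.strong_induction_on with
  | _ j ih =>
  match j with
  | 0 =>
    rw [inverseBorn, FormalMultilinearSeries.leftInv_coeff_zero]; rfl
  | 1 =>
    rw [inverseBorn, FormalMultilinearSeries.leftInv_coeff_one, hT]; rfl
  | n + 2 =>
    rw [inverseBorn, FormalMultilinearSeries.leftInv]
    simp only [WithLp.toLp_neg, WithLp.toLp_sum, neg_apply, sum_apply, neg_inj]
    -- `leftInv` sums over the same compositions, with the forward series precomposed with `i.symm`,
    -- so the terms agree one by one.
    refine Finset.sum_congr rfl fun c _ => ?_
    refine (ih _ c.2 _).trans ?_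
    refine Eq.trans ?_ (FormalMultilinearSeries.compAlongComposition_apply _ _ c.1 _).symm
    congr 1
    funext k
    refine Eq.trans ?_ (forwardSeries_apply Γ t R S 𝕜 hα p q _ _).symm
    congr 2
    funext m
    exact congrArg WithLp.ofLp (hT _)

end ForwardSeries

/-! ### The resolvent identity and solvability for small potentials. -/

section Resolvent

variable {V B : Type*} [Fintype V] [Fintype B] [DecidableEq V] [DecidableEq B]
  (Γ : SimpleGraph (V ⊕ B)) [DecidableRel Γ.Adj] (α₀ t : ℝ) {𝕜 : Type*} [RCLike 𝕜]

theorem diffusionMatrix_sub (η ζ : V → 𝕜) :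
    diffusionMatrix Γ α₀ t η - diffusionMatrix Γ α₀ t ζ
      = Matrix.diagonal (Sum.elim (fun v => (α₀ : 𝕜) * (η v - ζ v)) 0) := by
  ext x y
  cases x with
  | inl v =>
    simp only [diffusionMatrix, Matrix.sub_apply, Matrix.of_apply, diffusionOp,
      Matrix.diagonal_apply, Sum.elim_inl, Pi.single_apply]
    split_ifs <;> ring
  | inr b =>
    simp [diffusionMatrix, Matrix.sub_apply, Matrix.of_apply, diffusionOp, Matrix.diagonal_apply]

/-- The resolvent identity for Green's functions. -/
theorem greenMatrix_sub_apply {η ζ : V → 𝕜} (hη : IsUnit (diffusionMatrix Γ α₀ t η))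
    (hζ : IsUnit (diffusionMatrix Γ α₀ t ζ)) (x y : V ⊕ B) :
    greenMatrix Γ α₀ t ζ x y - greenMatrix Γ α₀ t η x y
      = ∑ v, greenMatrix Γ α₀ t ζ x (Sum.inl v) * ((α₀ : 𝕜) * (η v - ζ v))
          * greenMatrix Γ α₀ t η (Sum.inl v) y := by
  have hη' := (Matrix.isUnit_iff_isUnit_det _).mp hη
  have hζ' := (Matrix.isUnit_iff_isUnit_det _).mp hζ
  have h : greenMatrix Γ α₀ t ζ - greenMatrix Γ α₀ t η
      = greenMatrix Γ α₀ t ζ * Matrix.diagonal (Sum.elim (fun v => (α₀ : 𝕜) * (η v - ζ v)) 0)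
        * greenMatrix Γ α₀ t η := by
    rw [← diffusionMatrix_sub Γ α₀ t η ζ, mul_sub, sub_mul, mul_assoc, greenMatrix, greenMatrix,
      Matrix.mul_nonsing_inv _ hη', Matrix.nonsing_inv_mul _ hζ', mul_one, one_mul]
  rw [← Matrix.sub_apply, h, Matrix.mul_apply, Fintype.sum_sum_type]
  simp [Matrix.mul_diagonal]

variable {α₀ t}

theorem isUnit_diffusionMatrix_zero (hB : ∀ b : B, ∃ v : V, Γ.Adj (Sum.inr b) (Sum.inl v))
    (hα : 0 < α₀) (ht : 0 ≤ t) : IsUnit (diffusionMatrix Γ α₀ t (0 : V → 𝕜)) := by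
  have h := isUnit_diffusionMatrix (𝕜 := 𝕜) Γ α₀ t hB hα ht (0 : V → ℝ) fun _ => le_rfl
  convert h using 2
  funext v
  simp

/-- The boundary value problem is uniquely solvable for potentials with `μ_p ‖η‖_p < 1`. -/
theorem isUnit_diffusionMatrix_of_muConst_mul_lt_one
    (hB : ∀ b : B, ∃ v : V, Γ.Adj (Sum.inr b) (Sum.inl v))
    (hα : 0 < α₀) (ht : 0 ≤ t) {p q : ENNReal} (hpq : p.HolderConjugate q) {η : V → 𝕜}
    (hη : muConst Γ α₀ t 𝕜 q * lpNorm p η < 1) : IsUnit (diffusionMatrix Γ α₀ t η) := by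
  have h0 := isUnit_diffusionMatrix_zero (𝕜 := 𝕜) Γ hB hα ht
  have h0' := (Matrix.isUnit_iff_isUnit_det _).mp h0
  have hp : 1 ≤ p := ENNReal.HolderConjugate.one_le p q
  rw [← Matrix.mulVec_injective_iff_isUnit]
  refine (injective_iff_map_eq_zero (diffusionMatrix Γ α₀ t η).mulVecLin).mpr fun u hu => ?_
  rw [Matrix.mulVecLin_apply] at hu
  -- For a homogeneous solution `u`, the vector `x = D_η u` on `V` determines `u` and satisfies `x =
  -- -α₀ D_η G₀ x`. The right side contracts the `ℓ¹` norm by `μ_p ‖η‖_p < 1`, so `x = 0`.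
  set x : V → 𝕜 := (Matrix.diagonal η).mulVec fun v => u (Sum.inl v) with hx
  have hsolve : ∀ z, u z
      = -((α₀ : 𝕜) * ∑ w, greenMatrix Γ α₀ t (0 : V → 𝕜) z (Sum.inl w) * x w) := by
    intro z
    have h1 : (diffusionMatrix Γ α₀ t (0 : V → 𝕜)).mulVec u
        = -(Matrix.diagonal (Sum.elim (fun v => (α₀ : 𝕜) * (η v - (0 : V → 𝕜) v)) 0)).mulVec u := by
      rw [← diffusionMatrix_sub Γ α₀ t, Matrix.sub_mulVec, hu, zero_sub, neg_neg]
    have h2 : u = (greenMatrix Γ α₀ t (0 : V → 𝕜)).mulVec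
        ((diffusionMatrix Γ α₀ t (0 : V → 𝕜)).mulVec u) := by
      rw [Matrix.mulVec_mulVec, greenMatrix, Matrix.nonsing_inv_mul _ h0', Matrix.one_mulVec]
    rw [h1] at h2
    refine (congrFun h2 z).trans ?_
    rw [Matrix.mulVec_neg, Pi.neg_apply, Matrix.mulVec, dotProduct, Fintype.sum_sum_type,
      Finset.mul_sum]
    simp only [Matrix.mulVec_diagonal, hx, Sum.elim_inl, Sum.elim_inr, Pi.zero_apply, sub_zero,
      zero_mul, mul_zero, Finset.sum_const_zero, add_zero, neg_inj]
    exact Finset.sum_congr rfl fun w _ => by ring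
  have hfix : ∀ v, ‖x v‖
      = α₀ * ‖(Matrix.diagonal η * greenVV Γ α₀ t 𝕜).mulVec x v‖ := by
    intro v
    have h1 : x v = -((α₀ : 𝕜) * (Matrix.diagonal η * greenVV Γ α₀ t 𝕜).mulVec x v) := by
      rw [← Matrix.mulVec_mulVec, Matrix.mulVec_diagonal]
      conv_lhs => rw [hx, Matrix.mulVec_diagonal, hsolve]
      simp only [Matrix.mulVec, dotProduct, greenVV, greenZero, Matrix.submatrix_apply]
      ring
    conv_lhs => rw [h1]
    rw [norm_neg, norm_mul, RCLike.norm_ofReal, abs_of_pos hα]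
  have hle := sum_norm_diagonal_mul_mulVec_le hpq (greenVV Γ α₀ t 𝕜)
    (lpNorm_greenVV_le Γ t q) η x
  have hsum : ∑ v, ‖x v‖ ≤ muConst Γ α₀ t 𝕜 q * lpNorm p η * ∑ v, ‖x v‖ := by
    have hμ : muConst Γ α₀ t 𝕜 q = α₀ * greenColumnMax Γ α₀ t 𝕜 q := rfl
    calc ∑ v, ‖x v‖ = α₀ * ∑ v, ‖(Matrix.diagonal η * greenVV Γ α₀ t 𝕜).mulVec x v‖ := by
          rw [Finset.mul_sum]; exact Finset.sum_congr rfl fun v _ => hfix v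
      _ ≤ α₀ * (lpNorm p η * greenColumnMax Γ α₀ t 𝕜 q * ∑ v, ‖x v‖) := by gcongr
      _ = _ := by rw [hμ]; ring
  have hnn : 0 ≤ ∑ v, ‖x v‖ := Finset.sum_nonneg fun _ _ => norm_nonneg _
  have hzero : ∑ v, ‖x v‖ = 0 := by nlinarith
  have hx0 : ∀ v, x v = 0 := fun v => norm_eq_zero.mp
    ((Finset.sum_eq_zero_iff_of_nonneg fun _ _ => norm_nonneg _).mp hzero v (Finset.mem_univ v))
  funext z
  rw [hsolve z]
  simp [hx0]

end Resolvent

/-! ### Convergence of the forward Born series to the scattering data. -/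

section ForwardSum

variable {V B : Type*} [Fintype V] [Fintype B] [DecidableEq V] [DecidableEq B]
  (Γ : SimpleGraph (V ⊕ B)) [DecidableRel Γ.Adj] {α₀ t : ℝ} (R S : Finset B)
  {𝕜 : Type*} [RCLike 𝕜]

/-- The remainder after `n` terms of the forward Born series. -/
noncomputable def bornRemainder (α₀ t : ℝ) (η : V → 𝕜) (n : ℕ) (rs : R × S) : 𝕜 :=
  -(-(α₀ : 𝕜)) ^ (n + 1) * ∑ v, greenRV Γ α₀ t R 𝕜 rs.1 v *
    (Matrix.diagonal η * (greenVV Γ α₀ t 𝕜 * Matrix.diagonal η) ^ n).mulVec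
      (fun w => greenMatrix Γ α₀ t η (Sum.inl w) (Sum.inr rs.2.1)) v

theorem prod_ofFn_const {M : Type*} [Monoid M] (a : M) (n : ℕ) :
    (List.ofFn fun _ : Fin n => a).prod = a ^ n := by
  rw [List.ofFn_const, List.prod_replicate]

theorem scatteringData_eq_bornRemainder_zero
    (hB : ∀ b : B, ∃ v : V, Γ.Adj (Sum.inr b) (Sum.inl v)) (hα : 0 < α₀) (ht : 0 ≤ t) {η : V → 𝕜}
    (hη : IsUnit (diffusionMatrix Γ α₀ t η)) (rs : R × S) :
    scatteringData Γ α₀ t R S η rs = bornRemainder Γ R S α₀ t η 0 rs := by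
  have h0 := isUnit_diffusionMatrix_zero (𝕜 := 𝕜) Γ hB hα ht
  rw [scatteringData, robinToDirichlet, greenZero, greenMatrix_sub_apply Γ α₀ t hη h0,
    bornRemainder, Finset.mul_sum]
  refine Finset.sum_congr rfl fun v _ => ?_
  simp only [greenRV, greenZero, Matrix.submatrix_apply, pow_zero, mul_one, zero_add, pow_one,
    Matrix.mulVec_diagonal, Pi.zero_apply]
  ring

/-- The remainder ends in `G_η` where the Born term ends in `G₀`; substituting `G_η = G₀ - α₀ G₀ D_η
G_η` there splits off one Born term. -/
theorem bornRemainder_eq (hB : ∀ b : B, ∃ v : V, Γ.Adj (Sum.inr b) (Sum.inl v))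
    (hα : 0 < α₀) (ht : 0 ≤ t) {η : V → 𝕜}
    (hη : IsUnit (diffusionMatrix Γ α₀ t η)) (n : ℕ) (rs : R × S) :
    bornRemainder Γ R S α₀ t η n rs = forwardBorn Γ α₀ t R S (n + 1) (fun _ => η) rs
      + bornRemainder Γ R S α₀ t η (n + 1) rs := by
  have h0 := isUnit_diffusionMatrix_zero (𝕜 := 𝕜) Γ hB hα ht
  have hcol : (fun w => greenMatrix Γ α₀ t η (Sum.inl w) (Sum.inr rs.2.1))
      = (fun w => greenVS Γ α₀ t S 𝕜 w rs.2) - (α₀ : 𝕜) •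
        (greenVV Γ α₀ t 𝕜 * Matrix.diagonal η).mulVec
          (fun w => greenMatrix Γ α₀ t η (Sum.inl w) (Sum.inr rs.2.1)) := by
    funext w
    have h := greenMatrix_sub_apply Γ α₀ t hη h0 (Sum.inl w) (Sum.inr rs.2.1)
    simp only [Pi.sub_apply, Pi.smul_apply, ← Matrix.mulVec_mulVec, smul_eq_mul]
    rw [Matrix.mulVec, dotProduct, Finset.mul_sum]
    simp only [Matrix.mulVec_diagonal, greenVV, greenVS, greenZero, Matrix.submatrix_apply]
    rw [eq_sub_iff_add_eq, add_comm, ← eq_sub_iff_add_eq, h]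
    refine Finset.sum_congr rfl fun v _ => ?_
    simp only [Pi.zero_apply]
    ring
  rw [forwardBorn_succ_apply, prod_ofFn_const, bornRemainder, bornRemainder]
  conv_lhs => rw [hcol]
  rw [Matrix.mulVec_sub, Matrix.mulVec_smul, Matrix.mulVec_mulVec, mul_assoc (Matrix.diagonal η),
    ← pow_succ]
  simp only [Pi.sub_apply, Pi.smul_apply, smul_eq_mul, mul_sub, Finset.sum_sub_distrib]
  rw [sub_eq_add_neg, pow_succ (-(α₀ : 𝕜)) (n + 1)]
  congr 1
  rw [Finset.mul_sum, Finset.mul_sum, ← Finset.sum_neg_distrib]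
  exact Finset.sum_congr rfl fun v _ => by ring

theorem tendsto_bornRemainder (hα : 0 < α₀) {p q : ENNReal} (hpq : p.HolderConjugate q)
    {η : V → 𝕜} (hη : muConst Γ α₀ t 𝕜 q * lpNorm p η < 1) (rs : R × S) :
    Filter.Tendsto (fun n => bornRemainder Γ R S α₀ t η n rs) Filter.atTop (𝓝 0) := by
  have hp : 1 ≤ p := ENNReal.HolderConjugate.one_le p q
  have hqp : q.HolderConjugate p := ENNReal.HolderTriple.symm
  have hq : 1 ≤ q := ENNReal.HolderConjugate.one_le q p
  have hm : 0 ≤ muConst Γ α₀ t 𝕜 q * lpNorm p η :=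
    mul_nonneg (muConst_nonneg Γ t hα hq) (lpNorm_nonneg hp _)
  set y : V → 𝕜 := fun w => greenMatrix Γ α₀ t η (Sum.inl w) (Sum.inr rs.2.1) with hy
  have hlim := (tendsto_pow_atTop_nhds_zero_of_lt_one hm hη).const_mul
    (α₀ * lpNorm q (fun v => greenRV Γ α₀ t R 𝕜 rs.1 v) * lpNorm p η * lpNorm q y)
  rw [mul_zero] at hlim
  refine squeeze_zero_norm (fun n => ?_) hlim
  have h := sum_norm_diagonal_mul_prod_mulVec_le hpq (greenVV Γ α₀ t 𝕜)
    (greenColumnMax_nonneg Γ t hq) (lpNorm_greenVV_le Γ t q) y n fun _ => η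
  rw [prod_ofFn_const, Finset.prod_const, Finset.card_univ, Fintype.card_fin] at h
  rw [bornRemainder, norm_mul, norm_neg, norm_pow, norm_neg, RCLike.norm_ofReal, abs_of_pos hα]
  calc _ ≤ α₀ ^ (n + 1) * (lpNorm q (fun v => greenRV Γ α₀ t R 𝕜 rs.1 v)
        * (greenColumnMax Γ α₀ t 𝕜 q ^ n * lpNorm p η ^ (n + 1) * lpNorm q y)) := by
        gcongr
        refine (norm_sum_mul_le hq _ _).trans ?_
        exact mul_le_mul_of_nonneg_left h (lpNorm_nonneg hq _)
    _ = _ := by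
        have hμ : muConst Γ α₀ t 𝕜 q = α₀ * greenColumnMax Γ α₀ t 𝕜 q := rfl
        rw [hμ, mul_pow, mul_pow, pow_succ, pow_succ]
        ring

/-- The forward Born series sums to the scattering data for `μ_p ‖η‖_p < 1`. -/
theorem forwardSeries_sum (hB : ∀ b : B, ∃ v : V, Γ.Adj (Sum.inr b) (Sum.inl v))
    (hα : 0 < α₀) (ht : 0 ≤ t) (p q : ENNReal) [Fact (1 ≤ p)] [hpq : p.HolderConjugate q]
    (hμ : 0 < muConst Γ α₀ t 𝕜 q) (hν : 0 < nuConst Γ α₀ t R S 𝕜 p q) {η : V → 𝕜}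
    (hη : muConst Γ α₀ t 𝕜 q * lpNorm p η < 1) :
    (forwardSeries Γ t R S 𝕜 hα p q).sum (WithLp.toLp p η)
      = WithLp.toLp p (scatteringData Γ α₀ t R S η) := by
  have hunit := isUnit_diffusionMatrix_of_muConst_mul_lt_one Γ hB hα ht hpq hη
  have hs := FormalMultilinearSeries.hasSum_of_born_bound (P := forwardSeries Γ t R S 𝕜 hα p q)
    hμ hν rfl (norm_forwardSeries_succ_le Γ t R S 𝕜 hα p q) (x := WithLp.toLp p η) hη
  ext rs
  have h1 := ((PiLp.continuous_apply p _ rs).tendsto _).comp hs.tendsto_sum_nat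
  refine tendsto_nhds_unique h1 ?_
  have h2 : ∀ n, (∑ k ∈ Finset.range n, forwardSeries Γ t R S 𝕜 hα p q (k + 1)
      fun _ => WithLp.toLp p η).ofLp rs
        = scatteringData Γ α₀ t R S η rs - bornRemainder Γ R S α₀ t η n rs := by
    intro n
    rw [WithLp.ofLp_sum, Finset.sum_apply]
    induction n with
    | zero =>
      rw [scatteringData_eq_bornRemainder_zero Γ R S hB hα ht hunit]; simp
    | succ n ih =>
      rw [Finset.sum_range_succ, ih, forwardSeries_apply,
        bornRemainder_eq Γ R S hB hα ht hunit n rs]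
      ring
  have h3 := (tendsto_bornRemainder Γ R S hα hpq hη rs).const_sub
    (scatteringData Γ α₀ t R S η rs)
  rw [sub_zero] at h3
  exact h3.congr fun n => (h2 n).symm

end ForwardSum

/-! ### Positivity and monotonicity of Green's functions. -/

section Monotone

variable {V B : Type*} [Fintype V] [Fintype B]
  (Γ : SimpleGraph (V ⊕ B)) [DecidableRel Γ.Adj] {α₀ t : ℝ}

/-- Minimum principle: for a nonnegative potential, nonnegative data have nonnegative
solutions. -/
theorem nonneg_of_diffusionOp_nonneg (hB : ∀ b : B, ∃ v : V, Γ.Adj (Sum.inr b) (Sum.inl v))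
    (hα : 0 < α₀) (ht : 0 ≤ t) {η : V → ℝ} (hη : ∀ v, 0 ≤ η v) {u : V ⊕ B → ℝ}
    (hu : ∀ x, 0 ≤ diffusionOp Γ α₀ t η u x) (x : V ⊕ B) : 0 ≤ u x := by
  have hint : ∀ v : V, (∀ y, u (Sum.inl v) ≤ u y) → 0 ≤ u (Sum.inl v) := by
    intro v hv
    by_contra! hneg
    have h := hu (Sum.inl v)
    simp only [diffusionOp, RCLike.ofReal_real_eq_id, id_eq] at h
    have h1 : (∑ y : V ⊕ B, if Γ.Adj (Sum.inl v) y then u (Sum.inl v) - u y else 0) ≤ 0 :=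
      Finset.sum_nonpos fun y _ => by
        split_ifs
        · linarith [hv y]
        · exact le_rfl
    have hpos : 0 < α₀ * (1 + η v) := mul_pos hα (by linarith [hη v])
    nlinarith
  have hbd : ∀ b : B, (∀ y, u (Sum.inr b) ≤ u y) → 0 ≤ u (Sum.inr b) := by
    intro b hb
    by_contra! hneg
    obtain ⟨v, hv⟩ := hB b
    have h := hu (Sum.inr b)
    simp only [diffusionOp, RCLike.ofReal_real_eq_id, id_eq] at h
    have hterm : ∀ y : V, (if Γ.Adj (Sum.inr b) (Sum.inl y) then
        u (Sum.inr b) - u (Sum.inl y) else 0) ≤ 0 := fun y => by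
      split_ifs
      · linarith [hb (Sum.inl y)]
      · exact le_rfl
    have hle : (∑ y : V, if Γ.Adj (Sum.inr b) (Sum.inl y) then
        u (Sum.inr b) - u (Sum.inl y) else 0) ≤ u (Sum.inr b) - u (Sum.inl v) := by
      classical
      rw [← Finset.add_sum_erase _ _ (Finset.mem_univ v), if_pos hv]
      exact add_le_of_nonpos_right (Finset.sum_nonpos fun y _ => hterm y)
    -- Since `t * u b ≤ 0`, a negative minimum at a boundary vertex is also attained at its interior
    -- neighbour `v`.
    have hmin : u (Sum.inl v) ≤ u (Sum.inr b) := by nlinarith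
    have := hint v fun y => hmin.trans (hb y)
    linarith [hb (Sum.inl v)]
  obtain ⟨x₀, hx₀⟩ := @Finite.exists_min _ _ _ ⟨x⟩ _ u
  refine le_trans ?_ (hx₀ x)
  cases x₀ with
  | inl v => exact hint v hx₀
  | inr b => exact hbd b hx₀

variable [DecidableEq V] [DecidableEq B]

theorem greenMatrix_nonneg (hB : ∀ b : B, ∃ v : V, Γ.Adj (Sum.inr b) (Sum.inl v))
    (hα : 0 < α₀) (ht : 0 ≤ t) {η : V → ℝ} (hη : ∀ v, 0 ≤ η v) (x y : V ⊕ B) :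
    0 ≤ greenMatrix Γ α₀ t η x y := by
  have h := (diffusionOp_eq_iff (𝕜 := ℝ) Γ α₀ t hB hα ht η hη
    (Matrix.mulVec (greenMatrix Γ α₀ t η) (Pi.single y 1)) (Pi.single y 1)).mpr rfl
  have h1 := nonneg_of_diffusionOp_nonneg Γ hB hα ht hη
    (u := Matrix.mulVec (greenMatrix Γ α₀ t η) (Pi.single y 1)) (fun z => by
      have h2 : diffusionOp Γ α₀ t η (Matrix.mulVec (greenMatrix Γ α₀ t η) (Pi.single y 1)) z
        = (Pi.single y 1 : V ⊕ B → ℝ) z := congrFun h z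
      rw [h2, Pi.single_apply]
      split_ifs <;> norm_num) x
  simpa using h1

/-- The resolvent identity writes the difference as a sum of products of nonnegative factors. -/
theorem greenMatrix_antitone (hB : ∀ b : B, ∃ v : V, Γ.Adj (Sum.inr b) (Sum.inl v))
    (hα : 0 < α₀) (ht : 0 ≤ t) {η ζ : V → ℝ} (hζ : ∀ v, 0 ≤ ζ v) (hζη : ∀ v, ζ v ≤ η v)
    (x y : V ⊕ B) : greenMatrix Γ α₀ t η x y ≤ greenMatrix Γ α₀ t ζ x y := by
  have hη : ∀ v, 0 ≤ η v := fun v => (hζ v).trans (hζη v)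
  have h := greenMatrix_sub_apply Γ α₀ t (isUnit_diffusionMatrix (𝕜 := ℝ) Γ α₀ t hB hα ht η hη)
    (isUnit_diffusionMatrix (𝕜 := ℝ) Γ α₀ t hB hα ht ζ hζ) x y
  rw [← sub_nonneg]
  refine le_trans ?_ h.ge
  refine Finset.sum_nonneg fun v _ => mul_nonneg (mul_nonneg ?_ ?_) ?_
  · exact greenMatrix_nonneg Γ hB hα ht hζ _ _
  · exact mul_nonneg hα.le (sub_nonneg.mpr (hζη v))
  · exact greenMatrix_nonneg Γ hB hα ht hη _ _

/-- Matrix inversion commutes with the embedding of `ℝ`, so order arguments over `ℝ` also serve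
complex scalars. -/
theorem greenMatrix_ofReal {𝕜 : Type*} [RCLike 𝕜]
    (hB : ∀ b : B, ∃ v : V, Γ.Adj (Sum.inr b) (Sum.inl v))
    (hα : 0 < α₀) (ht : 0 ≤ t) {η : V → ℝ} (hη : ∀ v, 0 ≤ η v) (x y : V ⊕ B) :
    greenMatrix Γ α₀ t (fun v => (η v : 𝕜)) x y = ((greenMatrix Γ α₀ t η x y : ℝ) : 𝕜) := by
  have hM : diffusionMatrix Γ α₀ t (fun v => (η v : 𝕜))
      = (algebraMap ℝ 𝕜).mapMatrix (diffusionMatrix Γ α₀ t η) := by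
    ext x y
    have hsingle : ∀ z, ((Pi.single y 1 : V ⊕ B → ℝ) z : 𝕜) = (Pi.single y 1 : V ⊕ B → 𝕜) z := by
      intro z
      simp only [Pi.single_apply]
      split_ifs <;> simp
    cases x <;>
    · simp only [diffusionMatrix, RingHom.mapMatrix_apply, Matrix.map_apply, Matrix.of_apply,
        diffusionOp, ← hsingle, RCLike.algebraMap_eq_ofReal, RCLike.ofReal_real_eq_id, id_eq]
      push_cast [apply_ite (RCLike.ofReal : ℝ → 𝕜)]
      rfl
  have hdet := (Matrix.isUnit_iff_isUnit_det _).mp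
    (isUnit_diffusionMatrix (𝕜 := ℝ) Γ α₀ t hB hα ht η hη)
  have hG : greenMatrix Γ α₀ t (fun v => (η v : 𝕜))
      = (algebraMap ℝ 𝕜).mapMatrix (greenMatrix Γ α₀ t η) := by
    refine Matrix.inv_eq_right_inv ?_
    rw [hM, ← map_mul]
    exact (congrArg _ (Matrix.mul_nonsing_inv _ hdet)).trans (map_one _)
  rw [hG]
  rfl

/-- Scattering data increase in modulus with a nonnegative potential. -/
theorem norm_scatteringData_le {𝕜 : Type*} [RCLike 𝕜] (R S : Finset B)
    (hB : ∀ b : B, ∃ v : V, Γ.Adj (Sum.inr b) (Sum.inl v))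
    (hα : 0 < α₀) (ht : 0 ≤ t) {η ζ : V → ℝ} (hζ : ∀ v, 0 ≤ ζ v) (hζη : ∀ v, ζ v ≤ η v)
    (rs : R × S) :
    ‖scatteringData Γ α₀ t R S (fun v => (ζ v : 𝕜)) rs‖
      ≤ ‖scatteringData Γ α₀ t R S (fun v => (η v : 𝕜)) rs‖ := by
  have hη : ∀ v, 0 ≤ η v := fun v => (hζ v).trans (hζη v)
  have hzero : (0 : V → 𝕜) = fun v => (((0 : V → ℝ) v : ℝ) : 𝕜) := by funext v; simp
  have key : ∀ {θ : V → ℝ}, (∀ v, 0 ≤ θ v) →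
      ‖scatteringData Γ α₀ t R S (fun v => (θ v : 𝕜)) rs‖
        = greenMatrix Γ α₀ t (0 : V → ℝ) (Sum.inr rs.1.1) (Sum.inr rs.2.1)
          - greenMatrix Γ α₀ t θ (Sum.inr rs.1.1) (Sum.inr rs.2.1) := by
    intro θ hθ
    rw [scatteringData, robinToDirichlet, greenZero, hzero,
      greenMatrix_ofReal (η := 0) Γ hB hα ht (fun _ => le_rfl), greenMatrix_ofReal Γ hB hα ht hθ,
      ← RCLike.ofReal_sub, RCLike.norm_ofReal, abs_of_nonneg]
    exact sub_nonneg.mpr (greenMatrix_antitone Γ hB hα ht (fun _ => le_rfl) hθ _ _)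
  rw [key hζ, key hη]
  exact sub_le_sub_left (greenMatrix_antitone Γ hB hα ht hζ hζη _ _) _

end Monotone

/-- This keeps the infimum defining `C_p` from running over the empty set. -/
theorem exists_lpNorm_eq_one {V : Type*} [Fintype V] [Nonempty V] {𝕜 : Type*} [RCLike 𝕜]
    (p : ENNReal) [Fact (1 ≤ p)] : ∃ η : V → 𝕜, lpNorm p η = 1 := by
  classical
  obtain ⟨v⟩ := ‹Nonempty V›
  have hx : (WithLp.toLp p (Pi.single v 1) : PiLp p (fun _ : V => 𝕜)) ≠ 0 := by
    intro h
    have := congrArg (fun x : PiLp p (fun _ : V => 𝕜) => x v) h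
    simp at this
  exact ⟨_, norm_smul_inv_norm (𝕜 := 𝕜) hx⟩

/-! ### The linearized map and the constants `C_p`, `ν_p`. -/

section BornConstants

variable {V B : Type*} [Fintype V] [Fintype B] [DecidableEq V] [DecidableEq B]
  (Γ : SimpleGraph (V ⊕ B)) [DecidableRel Γ.Adj] {α₀ : ℝ} (t : ℝ) (R S : Finset B)
  {𝕜 : Type*} [RCLike 𝕜] (hα : 0 < α₀) (p q : ENNReal) [Fact (1 ≤ p)] [p.HolderConjugate q]

/-- The linearized forward map as a continuous linear equivalence, when it is bijective. -/
noncomputable def forwardEquiv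
    (hK : Function.Bijective fun η : V → 𝕜 => forwardBorn Γ α₀ t R S 1 fun _ => η) :
    PiLp p (fun _ : V => 𝕜) ≃L[𝕜] PiLp p (fun _ : R × S => 𝕜) :=
  (LinearEquiv.ofBijective
    (continuousMultilinearCurryFin1 𝕜 (PiLp p fun _ : V => 𝕜) (PiLp p fun _ : R × S => 𝕜)
      (forwardSeries Γ t R S 𝕜 hα p q 1)).toLinearMap
    (show Function.Bijective fun x : PiLp p (fun _ : V => 𝕜) =>
        forwardSeries Γ t R S 𝕜 hα p q 1 fun _ => x by
      simp only [forwardSeries_apply]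
      exact (WithLp.toLp_bijective p).comp (hK.comp (WithLp.ofLp_bijective p)))
    ).toContinuousLinearEquiv

variable (hK : Function.Bijective fun η : V → 𝕜 => forwardBorn Γ α₀ t R S 1 fun _ => η)

theorem forwardEquiv_apply (x : PiLp p (fun _ : V => 𝕜)) :
    forwardEquiv Γ t R S hα p q hK x
      = WithLp.toLp p (forwardBorn Γ α₀ t R S 1 fun _ => x.ofLp) :=
  forwardSeries_apply Γ t R S 𝕜 hα p q 1 fun _ => x

theorem forwardSeries_one :
    forwardSeries Γ t R S 𝕜 hα p q 1
      = (continuousMultilinearCurryFin1 𝕜 (PiLp p fun _ : V => 𝕜)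
          (PiLp p fun _ : R × S => 𝕜)).symm (forwardEquiv Γ t R S hα p q hK) := by
  ext1 x
  rw [continuousMultilinearCurryFin1_symm_apply, forwardSeries_apply]
  refine Eq.trans ?_ (forwardEquiv_apply Γ t R S hα p q hK (x 0)).symm
  congr 2
  funext i
  rw [Subsingleton.elim i 0]

theorem toLp_forwardEquiv_symm (φ : R × S → 𝕜) :
    WithLp.toLp p ((Equiv.ofBijective _ hK).symm φ)
      = (forwardEquiv Γ t R S hα p q hK).symm (WithLp.toLp p φ) := by
  rw [ContinuousLinearEquiv.eq_symm_apply, forwardEquiv_apply]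
  exact congrArg (WithLp.toLp p) ((Equiv.ofBijective _ hK).apply_symm_apply φ)

theorem cConst_le_lpNorm {η : V → 𝕜} (hη : lpNorm p η = 1) :
    cConst Γ α₀ t R S 𝕜 p ≤ lpNorm p (forwardBorn Γ α₀ t R S 1 fun _ => η) := by
  refine csInf_le ⟨0, ?_⟩ ⟨η, hη, rfl⟩
  rintro _ ⟨ζ, -, rfl⟩
  exact lpNorm_nonneg Fact.out _

theorem cConst_mul_norm_le (x : PiLp p (fun _ : V => 𝕜)) :
    cConst Γ α₀ t R S 𝕜 p * ‖x‖ ≤ ‖forwardEquiv Γ t R S hα p q hK x‖ := by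
  by_cases hx : x = 0
  · simp [hx]
  have hx' : 0 < ‖x‖ := norm_pos_iff.mpr hx
  have hone : ‖((‖x‖ : 𝕜)⁻¹ : 𝕜) • x‖ = 1 := norm_smul_inv_norm hx
  have h : cConst Γ α₀ t R S 𝕜 p
      ≤ ‖forwardEquiv Γ t R S hα p q hK (((‖x‖ : 𝕜)⁻¹ : 𝕜) • x)‖ := by
    generalize ((‖x‖ : 𝕜)⁻¹ : 𝕜) • x = y at hone ⊢
    rw [forwardEquiv_apply]
    exact cConst_le_lpNorm Γ t R S p hone
  rw [map_smul, norm_smul, norm_inv, RCLike.norm_ofReal, abs_norm, inv_mul_eq_div,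
    le_div_iff₀ hx'] at h
  exact h

end BornConstants

section BornConstantBounds

variable {V B : Type*} [Fintype V] [Fintype B] [DecidableEq V] [DecidableEq B]
  (Γ : SimpleGraph (V ⊕ B)) [DecidableRel Γ.Adj] {α₀ : ℝ} (t : ℝ) (R S : Finset B)
  {𝕜 : Type*} [RCLike 𝕜]

/-- The bounded inverse of `K₁` gives the lower bound `1 / ‖K₁⁻¹‖` on the unit sphere, without using
that the minimum is attained. -/
theorem cConst_pos (hα : 0 < α₀) (p q : ENNReal) [Fact (1 ≤ p)]
    [p.HolderConjugate q]
    (hK : Function.Bijective fun η : V → 𝕜 => forwardBorn Γ α₀ t R S 1 fun _ => η) [Nonempty V] :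
    0 < cConst Γ α₀ t R S 𝕜 p := by
  set i := forwardEquiv Γ t R S hα p q hK with hi
  have hbound : ∀ η : V → 𝕜, lpNorm p η = 1 →
      1 ≤ ‖(i.symm : PiLp p (fun _ : R × S => 𝕜) →L[𝕜] PiLp p (fun _ : V => 𝕜))‖
        * lpNorm p (forwardBorn Γ α₀ t R S 1 fun _ => η) := by
    intro η hη
    have h := (i.symm : PiLp p (fun _ : R × S => 𝕜) →L[𝕜] PiLp p (fun _ : V => 𝕜)).le_opNorm
      (i (WithLp.toLp p η))
    rw [ContinuousLinearEquiv.coe_coe, ContinuousLinearEquiv.symm_apply_apply, hi,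
      forwardEquiv_apply] at h
    exact hη.symm.le.trans h
  obtain ⟨η₀, hη₀⟩ := exists_lpNorm_eq_one (V := V) (𝕜 := 𝕜) p
  have hM : 0 < ‖(i.symm : PiLp p (fun _ : R × S => 𝕜) →L[𝕜] PiLp p (fun _ : V => 𝕜))‖ := by
    refine lt_of_le_of_ne (norm_nonneg _) fun h => ?_
    have := hbound η₀ hη₀
    rw [← h, zero_mul] at this
    linarith
  refine (one_div_pos.mpr hM).trans_le (le_csInf ⟨_, η₀, hη₀, rfl⟩ ?_)
  rintro _ ⟨η, hη, rfl⟩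
  rw [div_le_iff₀ hM, mul_comm]
  exact hbound η hη

theorem cConst_le_nuConst (hα : 0 < α₀) (p q : ENNReal) [Fact (1 ≤ p)]
    [p.HolderConjugate q] [Nonempty V] :
    cConst Γ α₀ t R S 𝕜 p ≤ nuConst Γ α₀ t R S 𝕜 p q := by
  obtain ⟨η, hη⟩ := exists_lpNorm_eq_one (V := V) (𝕜 := 𝕜) p
  have h2 := lpNorm_forwardBorn_succ_le Γ t R S hα ‹p.HolderConjugate q› 0 fun _ => η
  simp only [hη, Finset.prod_const_one, pow_zero, mul_one] at h2
  exact (cConst_le_lpNorm Γ t R S p hη).trans h2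

end BornConstantBounds

/-! ### Inversion of the scattering map and the main theorem. -/

section Inversion

variable {V B : Type*} [Fintype V] [Fintype B] [DecidableEq V] [DecidableEq B]
  (Γ : SimpleGraph (V ⊕ B)) [DecidableRel Γ.Adj] {α₀ t : ℝ} (R S : Finset B)
  {𝕜 : Type*} [RCLike 𝕜] (p q : ENNReal) [Fact (1 ≤ p)] [hpq : p.HolderConjugate q]

/-- Data in the ball of radius `r_p` are the scattering data of the sum of their inverse Born
series. -/
theorem exists_hasSum_inverseBorn [Nonempty V]
    (hB : ∀ b : B, ∃ v : V, Γ.Adj (Sum.inr b) (Sum.inl v)) (hα : 0 < α₀) (ht : 0 ≤ t)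
    (hK : Function.Bijective fun η : V → 𝕜 => forwardBorn Γ α₀ t R S 1 fun _ => η)
    (hμ : 0 < muConst Γ α₀ t 𝕜 q) {φ : R × S → 𝕜}
    (hφ : lpNorm p φ < bornRadius (cConst Γ α₀ t R S 𝕜 p) (muConst Γ α₀ t 𝕜 q)
      (nuConst Γ α₀ t R S 𝕜 p q)) :
    ∃ η : V → 𝕜, lpNorm p η < potentialRadius (cConst Γ α₀ t R S 𝕜 p) (muConst Γ α₀ t 𝕜 q)
        (nuConst Γ α₀ t R S 𝕜 p q) ∧
      IsUnit (diffusionMatrix Γ α₀ t η) ∧ scatteringData Γ α₀ t R S η = φ ∧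
      HasSum (fun j : ℕ => inverseBorn Γ α₀ t R S (Equiv.ofBijective _ hK).symm (j + 1)
        fun _ => φ) η := by
  have hC := cConst_pos Γ t R S hα p q hK
  have hν := hC.trans_le (cConst_le_nuConst Γ t R S hα p q)
  set i := forwardEquiv Γ t R S hα p q hK with hi
  set P := forwardSeries Γ t R S 𝕜 hα p q with hPdef
  have hlow := cConst_mul_norm_le Γ t R S hα p q hK
  have hP := norm_forwardSeries_succ_le Γ t R S 𝕜 hα p q
  have hP1 := forwardSeries_one Γ t R S hα p q hK
  have hlt := FormalMultilinearSeries.norm_rightInv_sum_lt hC hμ hν rfl hP i hlow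
    (y := WithLp.toLp p φ) hφ
  have hsum := FormalMultilinearSeries.hasSum_rightInv hC hμ hν rfl hP i hlow
    (y := WithLp.toLp p φ) hφ
  have hinv := FormalMultilinearSeries.sum_rightInv_sum hC hμ hν rfl hP i hP1 hlow
    (y := WithLp.toLp p φ) hφ
  have hμη := mul_lt_one_of_le_potentialRadius hC hμ hν hlt.le
  refine ⟨((P.rightInv i 0).sum (WithLp.toLp p φ)).ofLp, hlt,
    isUnit_diffusionMatrix_of_muConst_mul_lt_one Γ hB hα ht hpq hμη, ?_, ?_⟩
  · have h := forwardSeries_sum Γ R S hB hα ht p q hμ hν hμη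
    rw [WithLp.toLp_ofLp] at h
    exact WithLp.toLp_injective p (h.symm.trans hinv)
  -- The estimates concern the right inverse, while the inverse Born recursion is that of the left
  -- inverse; the two formal inverses coincide.
  · rw [← FormalMultilinearSeries.leftInv_eq_rightInv P i 0 hP1] at hsum ⊢
    have h := (PiLp.continuousLinearEquiv p 𝕜 (fun _ : V => 𝕜)).hasSum'.mpr hsum
    refine h.congr_fun fun j => ?_
    exact congrArg WithLp.ofLp (toLp_inverseBorn Γ t R S 𝕜 hα p q i _
      (toLp_forwardEquiv_symm Γ t R S hα p q hK) (j + 1) fun _ => φ)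

/-- The scattering data determine the potential within the ball of radius `ρ_p`. -/
theorem scatteringData_injOn [Nonempty V]
    (hB : ∀ b : B, ∃ v : V, Γ.Adj (Sum.inr b) (Sum.inl v)) (hα : 0 < α₀) (ht : 0 ≤ t)
    (hK : Function.Bijective fun η : V → 𝕜 => forwardBorn Γ α₀ t R S 1 fun _ => η)
    (hμ : 0 < muConst Γ α₀ t 𝕜 q) :
    Set.InjOn (scatteringData Γ α₀ t R S)
      {η : V → 𝕜 | lpNorm p η < potentialRadius (cConst Γ α₀ t R S 𝕜 p)
        (muConst Γ α₀ t 𝕜 q) (nuConst Γ α₀ t R S 𝕜 p q)} := by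
  have hC := cConst_pos Γ t R S hα p q hK
  have hν := hC.trans_le (cConst_le_nuConst Γ t R S hα p q)
  intro η hη ζ hζ h
  have hη' := mul_lt_one_of_le_potentialRadius hC hμ hν (le_of_lt hη)
  have hζ' := mul_lt_one_of_le_potentialRadius hC hμ hν (le_of_lt hζ)
  refine WithLp.toLp_injective p (FormalMultilinearSeries.sum_injOn_of_born_bound hC hμ hν rfl
    (norm_forwardSeries_succ_le Γ t R S 𝕜 hα p q)
    (fun x => (cConst_mul_norm_le Γ t R S hα p q hK x).trans_eq rfl)
    (mem_ball_zero_iff.mpr hη) (mem_ball_zero_iff.mpr hζ) ?_)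
  rw [forwardSeries_sum Γ R S hB hα ht p q hμ hν hη',
    forwardSeries_sum Γ R S hB hα ht p q hμ hν hζ', h]

/-- A nonnegative potential whose scattering data are smaller than `r_p` is smaller
than `ρ_p`. -/
theorem lpNorm_lt_potentialRadius_of_nonneg [Nonempty V]
    (hB : ∀ b : B, ∃ v : V, Γ.Adj (Sum.inr b) (Sum.inl v)) (hα : 0 < α₀) (ht : 0 ≤ t)
    (hK : Function.Bijective fun η : V → 𝕜 => forwardBorn Γ α₀ t R S 1 fun _ => η)
    (hμ : 0 < muConst Γ α₀ t 𝕜 q) {η : V → 𝕜}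
    (hη : ∀ v, 0 ≤ RCLike.re (η v) ∧ RCLike.im (η v) = 0)
    (hφ : lpNorm p (scatteringData Γ α₀ t R S η)
      < bornRadius (cConst Γ α₀ t R S 𝕜 p) (muConst Γ α₀ t 𝕜 q) (nuConst Γ α₀ t R S 𝕜 p q)) :
    lpNorm p η < potentialRadius (cConst Γ α₀ t R S 𝕜 p) (muConst Γ α₀ t 𝕜 q)
      (nuConst Γ α₀ t R S 𝕜 p q) := by
  have hp : 1 ≤ p := Fact.out
  have hC := cConst_pos Γ t R S hα p q hK
  have hν := hC.trans_le (cConst_le_nuConst Γ t R S hα p q)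
  by_contra! hge
  obtain ⟨ξ, hξ, hξρ, hdξ⟩ := exists_lt_bornMajorant hC hμ hν hφ
  have hpos : 0 < lpNorm p η := hξ.trans (hξρ.trans_le hge)
  -- The factor scales `η` to norm `ξ`; `s ≤ 1` makes the scaled potential pointwise smaller, so its
  -- data are no larger.
  set s : ℝ := ξ / lpNorm p η with hs
  have hs0 : 0 ≤ s := by positivity
  have hs1 : s ≤ 1 := (div_le_one hpos).mpr (hξρ.le.trans hge)
  have hηre : η = fun v => ((RCLike.re (η v) : ℝ) : 𝕜) := by
    funext v
    exact (RCLike.conj_eq_iff_re.mp (RCLike.conj_eq_iff_im.mpr (hη v).2)).symm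
  set ζ : V → 𝕜 := fun v => (s : 𝕜) • η v with hζ
  have hζre : ζ = fun v => ((s * RCLike.re (η v) : ℝ) : 𝕜) := by
    funext v
    simp only [hζ, smul_eq_mul, RCLike.ofReal_mul]
    rw [← congrFun hηre v]
  have hζnorm : lpNorm p ζ = ξ := by
    rw [hζ, lpNorm_smul hp, RCLike.norm_ofReal, abs_of_nonneg hs0, hs, div_mul_cancel₀ _ hpos.ne']
  have hμζ : muConst Γ α₀ t 𝕜 q * lpNorm p ζ < 1 := by
    rw [hζnorm]; exact mul_lt_one_of_le_potentialRadius hC hμ hν hξρ.le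
  have h1 := FormalMultilinearSeries.bornMajorant_le_norm_sum hμ hν rfl
    (norm_forwardSeries_succ_le Γ t R S 𝕜 hα p q)
    (fun x => (cConst_mul_norm_le Γ t R S hα p q hK x).trans_eq rfl) (x := WithLp.toLp p ζ) hμζ
  rw [forwardSeries_sum Γ R S hB hα ht p q hμ hν hμζ] at h1
  have hζnorm' : ‖WithLp.toLp p ζ‖ = ξ := hζnorm
  rw [hζnorm'] at h1
  have h2 : lpNorm p (scatteringData Γ α₀ t R S ζ)
      ≤ lpNorm p (scatteringData Γ α₀ t R S η) := by
    refine lpNorm_mono hp fun rs => ?_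
    rw [hζre]
    conv_rhs => rw [hηre]
    exact norm_scatteringData_le Γ R S hB hα ht (fun v => mul_nonneg hs0 (hη v).1)
      (fun v => mul_le_of_le_one_left (hη v).1 hs1) rs
  exact absurd (h1.trans h2) (not_le.mpr hdξ)

end Inversion

/-- `HasSum` is unconditional convergence, which in the finite-dimensional space `V → 𝕜` is absolute
convergence. `IsUnit` expresses unique solvability; without it `greenMatrix` would be the default
value of the matrix inverse. -/
theorem mainTheorem2 {𝕜 : Type*} [RCLike 𝕜] {V B : Type*} [Fintype V] [Fintype B]
    [DecidableEq V] [DecidableEq B] (Γ : SimpleGraph (V ⊕ B)) [DecidableRel Γ.Adj]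
    (hV : (Γ.comap Sum.inl).Connected)
    (hB : ∀ b : B, ∃ v : V, Γ.Adj (Sum.inr b) (Sum.inl v))
    (α₀ t : ℝ) (hα : 0 < α₀) (ht : 0 ≤ t) (R S : Finset B)
    (p q : ENNReal) (hpq : p.HolderConjugate q)
    (hcard : Fintype.card V = Fintype.card (R × S))
    (hK : Function.Bijective
      fun η : V → 𝕜 => forwardBorn Γ α₀ t R S 1 fun _ => η)
    (C μ ν r ρ : ℝ)
    (hC : C = cConst Γ α₀ t R S 𝕜 p)
    (hμ : μ = muConst Γ α₀ t 𝕜 q)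
    (hν : ν = nuConst Γ α₀ t R S 𝕜 p q)
    (hr : r = bornRadius C μ ν)
    (hρ : ρ = potentialRadius C μ ν) :
    (∀ η : V → 𝕜,
      ((∀ v, 0 ≤ RCLike.re (η v) ∧ RCLike.im (η v) = 0) ∨ lpNorm p η < ρ) →
      lpNorm p (scatteringData Γ α₀ t R S η) < r →
      HasSum
        (fun j : ℕ => inverseBorn Γ α₀ t R S (Equiv.ofBijective _ hK).symm (j + 1)
          fun _ => scatteringData Γ α₀ t R S η)
        η) ∧
    (∀ φ : R × S → 𝕜, lpNorm p φ < r →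
      ∃ η : V → 𝕜, lpNorm p η < ρ ∧ IsUnit (diffusionMatrix Γ α₀ t η) ∧
        scatteringData Γ α₀ t R S η = φ ∧
        HasSum
          (fun j : ℕ => inverseBorn Γ α₀ t R S (Equiv.ofBijective _ hK).symm (j + 1) fun _ => φ)
          η) := by

  have hp : 1 ≤ p := ENNReal.HolderConjugate.one_le p q
  have hqp : q.HolderConjugate p := ENNReal.HolderTriple.symm
  have hq : 1 ≤ q := ENNReal.HolderConjugate.one_le q p
  have : Fact (1 ≤ p) := ⟨hp⟩
  have : Nonempty V := hV.nonempty
  subst hC hμ hν hr hρ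
  -- If `μ_p = 0`, division by zero makes `bornRadius` equal to `0`, and no data satisfy the
  -- smallness hypothesis.
  rcases (muConst_nonneg Γ t (𝕜 := 𝕜) hα hq).eq_or_lt with hμ | hμ
  · have h0 : ∀ φ : R × S → 𝕜, ¬ lpNorm p φ < bornRadius (cConst Γ α₀ t R S 𝕜 p)
        (muConst Γ α₀ t 𝕜 q) (nuConst Γ α₀ t R S 𝕜 p q) := fun φ => by
      rw [← hμ, bornRadius, div_zero, zero_mul]
      exact not_lt.mpr (lpNorm_nonneg hp φ)
    exact ⟨fun η _ h => (h0 _ h).elim, fun φ h => (h0 _ h).elim⟩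
  refine ⟨fun η hη hφ => ?_, fun φ hφ =>
    exists_hasSum_inverseBorn Γ R S p q hB hα ht hK hμ hφ⟩
  obtain ⟨ζ, hζ, -, hζη, hsum⟩ := exists_hasSum_inverseBorn Γ R S p q hB hα ht hK hμ hφ
  have hηρ := hη.elim
    (fun h => lpNorm_lt_potentialRadius_of_nonneg Γ R S p q hB hα ht hK hμ h hφ) id
  rwa [scatteringData_injOn Γ R S p q hB hα ht hK hμ hζ hηρ hζη] at hsum
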